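/- Let $N\ge 2$ and $m\ge 3$. Let $G_0$ be a fixed finite graph (multiple edges and loops allowed), each vertex of which has a type in $\{1,\dots,N\}$, such that every type is carried by at least one vertex of positive degree. A random sequence of graphs $G_0,G_1,G_2,\dots$ is built as follows. Given $G_0,\dots,G_{t-1}$, choose $m$ vertices of $G_{t-1}$ independently and with replacement, each with probability proportional to its degree in $G_{t-1}$; then add one new vertex, joined by $m$ edges to the chosen vertices (with multiple edges if a vertex is chosen more than once), and give it a type chosen uniformly at random from the set of types present among the chosen vertices. Types never change once assigned. **Theorem (Pick random visible type).** Almost surely, for every type $i\in\{1,\dots,N\}$, both the proportion of vertices of $G_t$ that have type $i$ and the proportion of edge-ends of $G_t$ that lie at vertices of type $i$ (that is, the total degree of the vertices of type $i$ divided by the total degree of $G_t$) converge to $1/N$ as $t\to\infty$. -/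

import Mathlib

open MeasureTheory Filter Topology

noncomputable section

/-- A finite multigraph with at least one edge (parallel edges and loops are allowed), on the vertex
set `Fin n`, in which every vertex carries one of `N` types. -/
structure TypedGraph (N : ℕ) where
  /-- the number of vertices -/
  n : ℕ
  /-- the edges, with multiplicity -/
  edges : Multiset (Sym2 (Fin n))
  edges_ne_zero : edges ≠ 0
  /-- the type of each vertex -/
  type : Fin n → Fin N

namespace TypedGraph

variable {N : ℕ}

/-- There are only countably many typed graphs; they carry the discrete σ-algebra. -/
instance : MeasurableSpace (TypedGraph N) := ⊤

/-- The multiset of edge-ends: each edge contributes its two endpoints (a loop contributes its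
vertex twice). -/
def edgeEnds (G : TypedGraph N) : Multiset (Fin G.n) :=
  G.edges.bind Sym2.toMultiset

/-- The degree of a vertex is the number of edge-ends at it. -/
def degree (G : TypedGraph N) (v : Fin G.n) : ℕ :=
  G.edgeEnds.count v

/-- The total degree of the graph. -/
def totalDegree (G : TypedGraph N) : ℕ :=
  ∑ v, G.degree v

theorem totalDegree_eq (G : TypedGraph N) : G.totalDegree = 2 * Multiset.card G.edges := by
  unfold totalDegree degree
  rw [Multiset.sum_count_eq_card (fun a _ => Finset.mem_univ a)]
  simp only [edgeEnds, Multiset.card_bind]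
  have : (Multiset.card ∘ Sym2.toMultiset : Sym2 (Fin G.n) → ℕ) = fun _ => 2 := by
    funext e
    exact e.card_toMultiset
  rw [this]
  simp [mul_comm]

theorem totalDegree_pos (G : TypedGraph N) : 0 < G.totalDegree := by
  rw [totalDegree_eq]
  have := Multiset.card_pos.2 G.edges_ne_zero
  omega

/-- A vertex chosen at random with probability proportional to its degree. -/
def preferentialVertex (G : TypedGraph N) : PMF (Fin G.n) :=
  PMF.ofFintype (fun v => (G.degree v : ENNReal) / (G.totalDegree : ENNReal)) <| by
    simp only [div_eq_mul_inv]
    rw [← Finset.sum_mul, ← Nat.cast_sum]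
    exact ENNReal.mul_inv_cancel (by simpa [totalDegree] using G.totalDegree_pos.ne')
      (ENNReal.natCast_ne_top _)

/-- `m` vertices chosen independently, with replacement, each with probability proportional to its
degree. -/
def neighbours (G : TypedGraph N) (m : ℕ) : PMF (Fin m → Fin G.n) :=
  PMF.ofFintype (fun w => ∏ j, G.preferentialVertex (w j)) <| by
    rw [← Fintype.piFinset_univ,
      ← Finset.prod_univ_sum (fun _ => Finset.univ) (fun _ v => G.preferentialVertex v)]
    have h : ∑ v, G.preferentialVertex v = 1 := by
      have h' := G.preferentialVertex.tsum_coe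
      rwa [tsum_fintype] at h'
    simp [h]

/-- The types present among the vertices `w 0, …, w (m - 1)`. -/
def visibleTypes (G : TypedGraph N) {m : ℕ} (w : Fin m → Fin G.n) : Finset (Fin N) :=
  Finset.univ.image fun j => G.type (w j)

theorem visibleTypes_nonempty (G : TypedGraph N) {m : ℕ} (hm : 0 < m) (w : Fin m → Fin G.n) :
    (G.visibleTypes w).Nonempty :=
  ⟨G.type (w ⟨0, hm⟩), Finset.mem_image_of_mem _ (Finset.mem_univ _)⟩

/-- The graph obtained by adding one new vertex, of type `c`, joined by `m` edges to the vertices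
`w 0, …, w (m - 1)` (with parallel edges if some vertices coincide). -/
def addVertex (G : TypedGraph N) {m : ℕ} (w : Fin m → Fin G.n) (c : Fin N) : TypedGraph N where
  n := G.n + 1
  edges := G.edges.map (Sym2.map Fin.castSucc) +
    Finset.univ.val.map fun j => s((w j).castSucc, Fin.last G.n)
  edges_ne_zero := by
    simp [G.edges_ne_zero]
  type := Fin.snoc G.type c

/-- One step of the "pick random visible type" dynamics: choose `m` neighbours by preferential
attachment, then choose the type of the new vertex uniformly at random among the types present
among these neighbours. -/
def visibleStep (G : TypedGraph N) (m : ℕ) (hm : 0 < m) : PMF (TypedGraph N) :=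
  (G.neighbours m).bind fun w =>
    (PMF.uniformOfFinset (G.visibleTypes w) (G.visibleTypes_nonempty hm w)).map (G.addVertex w)

/-- The proportion of vertices that have type `i`. -/
def vertexProportion (G : TypedGraph N) (i : Fin N) : ℝ :=
  ((Finset.univ.filter fun v => G.type v = i).card : ℝ) / (G.n : ℝ)

/-- The proportion of edge-ends that lie at vertices of type `i`. -/
def degreeProportion (G : TypedGraph N) (i : Fin N) : ℝ :=
  (∑ v with G.type v = i, (G.degree v : ℝ)) / (G.totalDegree : ℝ)

end TypedGraph

/-- `G 0, G 1, …` is a random sequence of typed graphs, started from `G₀`, which follows the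
preferential attachment dynamics with the "pick random visible type" rule: conditionally on the
information `ℱ t` available at time `t` (any filtration to which the sequence is adapted, for
example the one that it generates), the graph `G (t + 1)` has law `(G t).visibleStep`. -/
structure IsVisibleTypeProcess {Ω : Type*} {mΩ : MeasurableSpace Ω} (μ : Measure Ω)
    (ℱ : Filtration ℕ mΩ) {N : ℕ} (m : ℕ) (hm : 0 < m) (G₀ : TypedGraph N)
    (G : ℕ → Ω → TypedGraph N) : Prop where
  adapted : ∀ t, Measurable[ℱ t] (G t)
  init : ∀ᵐ ω ∂μ, G 0 ω = G₀
  step : ∀ (t : ℕ) (H : TypedGraph N),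
    μ[({ω | G (t + 1) ω = H}).indicator (fun _ => (1 : ℝ)) | ℱ t] =ᵐ[μ]
      fun ω => ((G t ω).visibleStep m hm H).toReal

end

/-! Let `x i` be the proportion of edge-ends at type `i`, and let `r i` be the probability that the
new vertex has type `i`, divided by `x i`. The rule favours rare types: if `x i ≤ x j` then `r i ≥ r
j`. This follows by exchanging the letters `i` and `j` in the word of types seen by the new vertex
(`visibleRatio_sub_ge`). Since the `x i` and the `x i * r i` both sum to `1`, summing `(x j - x i) *
(r i - r j)` over all pairs gives `2 * ∑ (r i - 1)`, which therefore dominates a multiple of `∑ (x i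
- 1 / N) ^ 2` (`sum_visibleRatio_ge_sq`). The multiple is positive exactly because `m ≥ 3`; for `m =
2` every `r i` equals `1`.

The relative entropy `∑ -log (N * x i)` has drift `m / T * ∑ (1 - r i)` to first order, `T` being
the total degree. Two terms are added to it: a multiple of `1 / Y i`, with `Y i` the total degree of
type `i`, which absorbs the second-order error of the logarithm even when `Y i` is small; and `ε * β
i ^ 2`, where `β i` measures the edge-ends not created with their own vertex and so gives access to
the vertex proportions. The resulting potential decreases on average by `decayRate / T`, up to an
error `O(1 / T ^ 2)` (`stepMean_potential_le`).

By Robbins–Siegmund the potential converges almost surely and `decayRate / T` is summable. As `T`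
grows linearly, `decayRate` comes arbitrarily close to `0` infinitely often; there the potential is
also close to `0`, so its limit is `0`. It controls each `x i - 1 / N` and each `β i`, whence both
limits. -/

noncomputable section

/-! ### Random words of types and the exchange argument -/

namespace TypeWord

set_option linter.unusedSectionVars false

variable {ι : Type*} [Fintype ι] [DecidableEq ι]

/-- The letters that occur in a word. -/
def letters {m : ℕ} (u : Fin m → ι) : Finset ι := Finset.univ.image u

/-- The number of occurrences of a letter in a word. -/
def occ {m : ℕ} (u : Fin m → ι) (i : ι) : ℕ := (Finset.univ.filter fun k => u k = i).card

/-- The weight of a word whose letters are drawn independently with weights `x`. -/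
def weight (x : ι → ℝ) {m : ℕ} (u : Fin m → ι) : ℝ := ∏ k, x (u k)

/-- The probability that a letter drawn uniformly among those visible in a random word is `i`. -/
def visibleProb (x : ι → ℝ) (m : ℕ) (i : ι) : ℝ :=
  ∑ u : Fin m → ι, weight x u * (if i ∈ letters u then ((letters u).card : ℝ)⁻¹ else 0)

/-- The share of the letter `i` in the word obtained by appending `i` to `u`, divided among the
occurrences of `i`. -/
def share {m : ℕ} (u : Fin m → ι) (i : ι) : ℝ :=
  (((1 + occ u i : ℕ) : ℝ) * ((insert i (letters u)).card : ℝ))⁻¹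

/-- The quotient of `visibleProb x (n + 1) i` by `x i`, as a polynomial in `x`. -/
def visibleRatio (x : ι → ℝ) (n : ℕ) (i : ι) : ℝ :=
  (n + 1) * ∑ u : Fin n → ι, weight x u * share u i

theorem mem_letters {m : ℕ} {u : Fin m → ι} {i : ι} : i ∈ letters u ↔ ∃ k, u k = i := by
  simp [letters]

theorem occ_pos {m : ℕ} {u : Fin m → ι} {i : ι} : 0 < occ u i ↔ i ∈ letters u := by
  simp [letters, occ, Finset.card_pos, Finset.filter_nonempty_iff]

theorem occ_le {m : ℕ} (u : Fin m → ι) (i : ι) : occ u i ≤ m := by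
  simpa [occ] using Finset.card_filter_le (Finset.univ : Finset (Fin m)) (fun k => u k = i)

theorem sum_weight {x : ι → ℝ} (hx : ∑ i, x i = 1) (m : ℕ) :
    ∑ u : Fin m → ι, weight x u = 1 := by
  unfold weight
  rw [← Fintype.piFinset_univ,
    ← Finset.prod_univ_sum (fun _ => Finset.univ) (fun _ v => x v)]
  simp [hx]

theorem weight_nonneg {x : ι → ℝ} (hx : ∀ i, 0 ≤ x i) {m : ℕ} (u : Fin m → ι) :
    0 ≤ weight x u := Finset.prod_nonneg fun _ _ => hx _

theorem sum_words_insertNth {n : ℕ} (k : Fin (n + 1)) (f : (Fin (n + 1) → ι) → ℝ) :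
    ∑ u, f u = ∑ a, ∑ u : Fin n → ι, f (k.insertNth (α := fun _ => ι) a u) := by
  rw [← Fintype.sum_prod_type']
  exact (Equiv.sum_comp (Fin.insertNthEquiv (fun _ => ι) k) f).symm

theorem weight_insertNth (x : ι → ℝ) {n : ℕ} (k : Fin (n + 1)) (a : ι) (u : Fin n → ι) :
    weight x (k.insertNth (α := fun _ => ι) a u) = x a * weight x u := by
  simp [weight, Fin.prod_univ_succAbove _ k]

theorem occ_insertNth {n : ℕ} (k : Fin (n + 1)) (i : ι) (u : Fin n → ι) :
    occ (k.insertNth (α := fun _ => ι) i u) i = 1 + occ u i := by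
  simp only [occ, Finset.card_filter]
  simp [Fin.sum_univ_succAbove _ k]

theorem letters_insertNth {n : ℕ} (k : Fin (n + 1)) (i : ι) (u : Fin n → ι) :
    letters (k.insertNth (α := fun _ => ι) i u) = insert i (letters u) := by
  ext a
  simp only [mem_letters, Finset.mem_insert, Fin.exists_iff_succAbove k, Fin.insertNth_apply_same,
    Fin.insertNth_apply_succAbove]
  tauto

theorem sum_weight_mul_occ {x : ι → ℝ} (hx : ∑ i, x i = 1) (m : ℕ) (i : ι) :
    ∑ u : Fin m → ι, weight x u * (occ u i : ℝ) = m * x i := by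
  cases m with
  | zero => simp [occ]
  | succ n =>
    have h : ∀ u : Fin (n + 1) → ι, weight x u * (occ u i : ℝ) =
        ∑ k, if u k = i then weight x u else 0 := by
      intro u
      rw [← Finset.sum_filter, Finset.sum_const, nsmul_eq_mul, mul_comm]
      rfl
    simp_rw [h]
    rw [Finset.sum_comm]
    have h2 : ∀ k : Fin (n + 1), ∑ u : Fin (n + 1) → ι, (if u k = i then weight x u else 0)
        = x i := by
      intro k
      rw [sum_words_insertNth k]
      simp only [Fin.insertNth_apply_same, weight_insertNth]
      rw [Finset.sum_eq_single i]
      · simp [← Finset.mul_sum, sum_weight hx]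
      · intro b _ hb; simp [hb]
      · simp
    simp [h2]

/-- Split the contribution of a word evenly among its occurrences of `i`, then delete the marked
occurrence. The `n + 1` positions contribute equally, and the deleted letter yields the factor `x
i`. -/
theorem visibleProb_eq (x : ι → ℝ) (n : ℕ) (i : ι) :
    visibleProb x (n + 1) i = x i * visibleRatio x n i := by
  have h : ∀ u : Fin (n + 1) → ι,
      weight x u * (if i ∈ letters u then ((letters u).card : ℝ)⁻¹ else 0) =
        ∑ k, if u k = i then weight x u * ((occ u i : ℝ) * ((letters u).card : ℝ))⁻¹ else 0 := by
    intro u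
    rw [← Finset.sum_filter, Finset.sum_const, nsmul_eq_mul]
    change _ = (occ u i : ℝ) * _
    split_ifs with hi
    · have : (occ u i : ℝ) ≠ 0 := by exact_mod_cast (occ_pos.2 hi).ne'
      rw [mul_inv]; field_simp
    · have : occ u i = 0 := by
        by_contra h0
        exact hi (occ_pos.1 (Nat.pos_of_ne_zero h0))
      simp [this]
  unfold visibleProb
  simp_rw [h]
  rw [Finset.sum_comm]
  have h2 : ∀ k : Fin (n + 1), ∑ u : Fin (n + 1) → ι,
      (if u k = i then weight x u * ((occ u i : ℝ) * ((letters u).card : ℝ))⁻¹ else 0)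
        = x i * ∑ u : Fin n → ι, weight x u * share u i := by
    intro k
    rw [sum_words_insertNth k]
    simp only [Fin.insertNth_apply_same]
    rw [Finset.sum_eq_single i]
    · simp only [if_true, weight_insertNth, occ_insertNth, letters_insertNth, Finset.mul_sum,
        share]
      exact Finset.sum_congr rfl fun u _ => by ring
    · intro b _ hb; simp [hb]
    · simp
  simp only [h2, visibleRatio, Finset.sum_const, Finset.card_univ, Fintype.card_fin, nsmul_eq_mul]
  push_cast
  ring

theorem sum_visibleProb {x : ι → ℝ} (hx : ∑ i, x i = 1) (n : ℕ) :
    ∑ i, visibleProb x (n + 1) i = 1 := by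
  unfold visibleProb
  rw [Finset.sum_comm, ← sum_weight hx (n + 1)]
  refine Finset.sum_congr rfl fun u _ => ?_
  rw [← Finset.mul_sum, Finset.sum_ite_mem, Finset.univ_inter, Finset.sum_const, nsmul_eq_mul,
    mul_inv_cancel₀, mul_one]
  have : (letters u).Nonempty := ⟨u 0, mem_letters.2 ⟨0, rfl⟩⟩
  exact_mod_cast this.card_pos.ne'

theorem visibleRatio_nonneg {x : ι → ℝ} (hx : ∀ i, 0 ≤ x i) (n : ℕ) (i : ι) :
    0 ≤ visibleRatio x n i := by
  unfold visibleRatio share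
  have := fun u : Fin n → ι => weight_nonneg hx u
  have h2 : ∀ u : Fin n → ι, 0 ≤ weight x u *
    (((1 + occ u i : ℕ) : ℝ) * ((insert i (letters u)).card : ℝ))⁻¹ := fun u =>
    mul_nonneg (this u) (by positivity)
  exact mul_nonneg (by positivity) (Finset.sum_nonneg fun u _ => h2 u)

/-- A letter which occurs less often has a larger share. -/
theorem share_le_share {m : ℕ} (u : Fin m → ι) {i j : ι} (h : occ u i ≤ occ u j) :
    share u j ≤ share u i := by
  unfold share
  have hpos : 0 < (insert i (letters u)).card := Finset.card_pos.2 ⟨i, by simp⟩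
  apply inv_anti₀
  · positivity
  norm_cast
  by_cases hi : i ∈ letters u
  · have hj : j ∈ letters u := occ_pos.1 ((occ_pos.2 hi).trans_le h)
    rw [Finset.insert_eq_of_mem hi, Finset.insert_eq_of_mem hj]
    gcongr
  · have hi0 : occ u i = 0 := by
      by_contra h0
      exact hi (occ_pos.1 (Nat.pos_of_ne_zero h0))
    rw [Finset.card_insert_of_notMem hi, hi0]
    by_cases hj : j ∈ letters u
    · rw [Finset.insert_eq_of_mem hj]
      have := occ_pos.2 hj
      have h3 : 0 < (letters u).card := Finset.card_pos.2 ⟨j, hj⟩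
      nlinarith
    · rw [Finset.card_insert_of_notMem hj]
      nlinarith [Nat.zero_le (occ u j), Nat.zero_le (letters u).card]

/-- The word with the letters `i` and `j` exchanged. -/
def swapWord (i j : ι) {m : ℕ} (u : Fin m → ι) : Fin m → ι := fun k => Equiv.swap i j (u k)

theorem swapWord_swapWord (i j : ι) {m : ℕ} (u : Fin m → ι) :
    swapWord i j (swapWord i j u) = u := by
  funext k; simp [swapWord]

theorem occ_swapWord (i j a : ι) {m : ℕ} (u : Fin m → ι) :
    occ (swapWord i j u) a = occ u (Equiv.swap i j a) := by
  unfold occ swapWord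
  congr 1
  ext k
  simp [Equiv.swap_apply_eq_iff]

theorem share_swapWord (i j : ι) {m : ℕ} (u : Fin m → ι) :
    share (swapWord i j u) i = share u j := by
  unfold share
  rw [occ_swapWord, Equiv.swap_apply_left]
  congr 3
  rw [← Finset.card_image_of_injective (insert j (letters u)) (Equiv.swap i j).injective]
  congr 1
  rw [Finset.image_insert, Equiv.swap_apply_right, letters, letters, Finset.image_image]
  rfl

theorem sum_swapWord (i j : ι) {m : ℕ} (f : (Fin m → ι) → ℝ) :
    ∑ u, f (swapWord i j u) = ∑ u, f u :=
  Function.Bijective.sum_comp (Function.Involutive.bijective (swapWord_swapWord i j)) f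

/-- Isolates the only factors that change when `i` and `j` are exchanged. -/
theorem weight_eq (x : ι → ℝ) {i j : ι} (hij : i ≠ j) {m : ℕ} (u : Fin m → ι) :
    weight x u = x i ^ occ u i * x j ^ occ u j *
      ∏ k, (if u k = i ∨ u k = j then 1 else x (u k)) := by
  have h : ∀ a : ι, x a ^ occ u a = ∏ k, if u k = a then x a else 1 := by
    intro a
    rw [Finset.prod_ite]
    simp [occ]
  rw [h, h, ← Finset.prod_mul_distrib, ← Finset.prod_mul_distrib, weight]
  refine Finset.prod_congr rfl fun k _ => ?_
  by_cases h1 : u k = i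
  · simp [h1, hij]
  · by_cases h2 : u k = j
    · simp [h2, hij.symm]
    · simp [h1, h2]

/-- With `d = occ u j - occ u i`, the exchange replaces a factor `x j ^ d` by `x i ^ d`. -/
theorem weight_swapWord_le {x : ι → ℝ} (hx : ∀ i, 0 ≤ x i) {i j : ι} (hij : x i ≤ x j) {m : ℕ}
    (u : Fin m → ι) (h : occ u i ≤ occ u j) : weight x (swapWord i j u) ≤ weight x u := by
  by_cases hne : i = j
  · subst hne
    have : swapWord i i u = u := by funext k; simp [swapWord]
    rw [this]
  rw [weight_eq x hne, weight_eq x hne u, occ_swapWord, occ_swapWord, Equiv.swap_apply_left,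
    Equiv.swap_apply_right]
  have hrest : ∏ k, (if swapWord i j u k = i ∨ swapWord i j u k = j then 1
      else x (swapWord i j u k)) = ∏ k, (if u k = i ∨ u k = j then 1 else x (u k)) := by
    refine Finset.prod_congr rfl fun k _ => ?_
    by_cases h1 : u k = i
    · simp [swapWord, h1]
    · by_cases h2 : u k = j
      · simp [swapWord, h2]
      · simp [swapWord, h1, h2, Equiv.swap_apply_of_ne_of_ne h1 h2]
  rw [hrest]
  refine mul_le_mul_of_nonneg_right ?_ (Finset.prod_nonneg fun k _ => ?_)
  · obtain ⟨d, hd⟩ := Nat.exists_eq_add_of_le h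
    rw [hd, pow_add, pow_add]
    have h1 : x i ^ d ≤ x j ^ d := pow_le_pow_left₀ (hx i) hij d
    have h2 : 0 ≤ x i ^ occ u i * x j ^ occ u i :=
      mul_nonneg (pow_nonneg (hx i) _) (pow_nonneg (hx j) _)
    nlinarith
  · split_ifs
    · exact zero_le_one
    · exact hx _

/-- The exchange argument: the rarer of two letters has the larger ratio. -/
theorem visibleRatio_sub_ge {x : ι → ℝ} (hx : ∀ i, 0 ≤ x i) {n : ℕ} (hn : 1 ≤ n) {i j : ι}
    (hij : x i ≤ x j) :
    ((n : ℝ) - 1) / 4 * (x j ^ n - x i ^ n) ≤ visibleRatio x n i - visibleRatio x n j := by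
  by_cases hne : i = j
  · subst hne; simp
  -- Averaging the difference with its image under the exchange pairs `weight` and `share`
  -- increments, which have the same sign word by word.
  have key : visibleRatio x n i - visibleRatio x n j =
      (n + 1) / 2 * ∑ u : Fin n → ι,
        (weight x u - weight x (swapWord i j u)) * (share u i - share u j) := by
    have h1 : ∑ u : Fin n → ι, weight x (swapWord i j u) * share u i =
        ∑ u : Fin n → ι, weight x u * share u j := by
      rw [← sum_swapWord i j fun u => weight x (swapWord i j u) * share u i]
      simp only [swapWord_swapWord, share_swapWord]
    have h2 : ∑ u : Fin n → ι, weight x (swapWord i j u) * share u j =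
        ∑ u : Fin n → ι, weight x u * share u i := by
      rw [← sum_swapWord i j fun u => weight x u * share u i]
      simp only [share_swapWord]
    simp only [sub_mul, mul_sub, Finset.sum_sub_distrib, h1, h2, visibleRatio]
    ring
  have hterm : ∀ u : Fin n → ι,
      0 ≤ (weight x u - weight x (swapWord i j u)) * (share u i - share u j) := by
    intro u
    rcases le_total (occ u i) (occ u j) with h | h
    · exact mul_nonneg (sub_nonneg.2 (weight_swapWord_le hx hij u h))
        (sub_nonneg.2 (share_le_share u h))
    · have := weight_swapWord_le hx hij (swapWord i j u) (by simpa [occ_swapWord] using h)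
      rw [swapWord_swapWord] at this
      exact mul_nonneg_of_nonpos_of_nonpos (sub_nonpos.2 this)
        (sub_nonpos.2 (share_le_share u h))
  -- Only the constant word `j … j` is kept. Its share difference `1 / 2 - 1 / (n + 1)`, times `(n +
  -- 1) / 2`, is the constant `(n - 1) / 4`.
  have hsingle := Finset.single_le_sum (fun u _ => hterm u)
    (Finset.mem_univ (fun _ : Fin n => j))
  have hlet : letters (fun _ : Fin n => j) = {j} := by
    ext a
    simp only [mem_letters, Finset.mem_singleton]
    exact ⟨fun ⟨_, h⟩ => h.symm, fun h => ⟨⟨0, hn⟩, h.symm⟩⟩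
  have hsi : share (fun _ : Fin n => j) i = 1 / 2 := by
    have : occ (fun _ : Fin n => j) i = 0 := by simp [occ, Ne.symm hne]
    rw [share, hlet, this, Finset.card_insert_of_notMem (by simpa using hne)]
    norm_num
  have hsj : share (fun _ : Fin n => j) j = 1 / (n + 1) := by
    have : occ (fun _ : Fin n => j) j = n := by simp [occ]
    rw [share, hlet, this]
    simp [add_comm]
  have hw : weight x (fun _ : Fin n => j) = x j ^ n := by simp [weight]
  have hw' : weight x (swapWord i j (fun _ : Fin n => j)) = x i ^ n := by simp [weight, swapWord]
  rw [hsi, hsj, hw, hw'] at hsingle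
  rw [key]
  have hn0 : (0 : ℝ) < n + 1 := by positivity
  calc ((n : ℝ) - 1) / 4 * (x j ^ n - x i ^ n)
      = (n + 1) / 2 * ((x j ^ n - x i ^ n) * (1 / 2 - 1 / (n + 1))) := by field_simp; ring
    _ ≤ _ := mul_le_mul_of_nonneg_left hsingle (by positivity)

/-- The sum of `(x j - x i) * (r i - r j)` over ordered pairs equals `2 * ∑ (r i - 1)` and has
nonnegative terms; the bound keeps `(l, k)` and `(k, l)`. -/
theorem sum_visibleRatio_ge {x : ι → ℝ} (hx : ∀ i, 0 < x i) (hx1 : ∑ i, x i = 1) {n : ℕ}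
    (hn : 1 ≤ n) (k l : ι) (hlk : x l ≤ x k) :
    ((n : ℝ) - 1) / 4 * ((x k - x l) * (x k ^ n - x l ^ n)) ≤
      ∑ i : ι, (visibleRatio x n i - 1) := by
  have hx0 : ∀ i, 0 ≤ x i := fun i => (hx i).le
  set r := visibleRatio x n with hr
  have hxr : ∑ i, x i * r i = 1 := by
    rw [← sum_visibleProb hx1 n]
    exact Finset.sum_congr rfl fun i _ => (visibleProb_eq x n i).symm
  have hsum : ∑ p : ι × ι, (x p.2 - x p.1) * (r p.1 - r p.2) = 2 * ∑ i, (r i - 1) := by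
    rw [Fintype.sum_prod_type]
    have h1 : ∑ i : ι, ∑ j : ι, x j * r i = ∑ i, r i := by
      simp_rw [← Finset.sum_mul, hx1, one_mul]
    have h2 : ∑ _i : ι, ∑ j : ι, x j * r j = Fintype.card ι := by
      simp [hxr]
    have h3 : ∑ i : ι, ∑ _j : ι, x i * r i = Fintype.card ι := by
      simp only [Finset.sum_const, nsmul_eq_mul, Finset.card_univ, ← Finset.mul_sum, hxr, mul_one]
    have h4 : ∑ i : ι, ∑ j : ι, x i * r j = ∑ i, r i := by
      simp_rw [← Finset.mul_sum, ← Finset.sum_mul, hx1, one_mul]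
    simp only [sub_mul, mul_sub, Finset.sum_sub_distrib, h1, h2, h3, h4]
    simp
    ring
  have hterm : ∀ i j, ((n : ℝ) - 1) / 4 * ((x j - x i) * (x j ^ n - x i ^ n)) ≤
      (x j - x i) * (r i - r j) := by
    intro i j
    rcases le_total (x i) (x j) with h | h
    · have := mul_le_mul_of_nonneg_left (visibleRatio_sub_ge hx0 hn h) (sub_nonneg.2 h)
      linarith
    · have := mul_le_mul_of_nonneg_left (visibleRatio_sub_ge hx0 hn h) (sub_nonneg.2 h)
      linarith
  have hn' : (1 : ℝ) ≤ n := by exact_mod_cast hn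
  have hterm0 : ∀ i j, 0 ≤ (x j - x i) * (r i - r j) := by
    intro i j
    refine le_trans (mul_nonneg (by linarith) ?_) (hterm i j)
    rcases le_total (x i) (x j) with h | h
    · exact mul_nonneg (sub_nonneg.2 h) (sub_nonneg.2 (pow_le_pow_left₀ (hx0 i) h n))
    · exact mul_nonneg_of_nonpos_of_nonpos (sub_nonpos.2 h)
        (sub_nonpos.2 (pow_le_pow_left₀ (hx0 j) h n))
  by_cases hne : l = k
  · subst hne
    have : 0 ≤ ∑ p : ι × ι, (x p.2 - x p.1) * (r p.1 - r p.2) :=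
      Finset.sum_nonneg fun p _ => hterm0 p.1 p.2
    simp only [sub_self, mul_zero]
    linarith
  · have hpair : ∑ p ∈ ({(l, k), (k, l)} : Finset (ι × ι)), (x p.2 - x p.1) * (r p.1 - r p.2) ≤
        ∑ p : ι × ι, (x p.2 - x p.1) * (r p.1 - r p.2) :=
      Finset.sum_le_sum_of_subset_of_nonneg (Finset.subset_univ _)
        fun p _ _ => hterm0 p.1 p.2
    rw [Finset.sum_pair (by simp [hne]), hsum] at hpair
    have := hterm l k
    simp only at hpair
    linarith

/-- The total ratio exceeds the number of letters by a quadratic amount. -/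
theorem sum_visibleRatio_ge_sq [Nonempty ι] {x : ι → ℝ} (hx : ∀ i, 0 < x i)
    (hx1 : ∑ i, x i = 1) {n : ℕ} (hn : 2 ≤ n) :
    ((n : ℝ) - 1) / 4 * (1 / Fintype.card ι : ℝ) ^ n *
      ∑ i, (x i - 1 / Fintype.card ι) ^ 2 ≤ ∑ i, (visibleRatio x n i - 1) := by
  obtain ⟨k, -, hk⟩ := Finset.exists_max_image Finset.univ x Finset.univ_nonempty
  obtain ⟨l, -, hl⟩ := Finset.exists_min_image Finset.univ x Finset.univ_nonempty
  have hk' : ∀ i, x i ≤ x k := fun i => hk i (Finset.mem_univ i)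
  have hl' : ∀ i, x l ≤ x i := fun i => hl i (Finset.mem_univ i)
  set c : ℝ := (Fintype.card ι : ℝ) with hc
  have hc0 : 0 < c := by
    rw [hc]; exact_mod_cast Fintype.card_pos
  have hmax : 1 / c ≤ x k := by
    have : ∑ i, x i ≤ ∑ _i : ι, x k := Finset.sum_le_sum fun i _ => hk' i
    rw [hx1, Finset.sum_const, Finset.card_univ, nsmul_eq_mul, ← hc] at this
    rw [div_le_iff₀ hc0]; linarith
  have hmin : x l ≤ 1 / c := by
    have : ∑ _i : ι, x l ≤ ∑ i, x i := Finset.sum_le_sum fun i _ => hl' i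
    rw [hx1, Finset.sum_const, Finset.card_univ, nsmul_eq_mul, ← hc] at this
    rw [le_div_iff₀ hc0]; linarith
  -- All `x i` and the mean `1 / c` lie between `x l` and `x k`. The factor `c` lost here is paid
  -- for by one of the `n` powers of `1 / c`.
  have hsq : ∑ i, (x i - 1 / c) ^ 2 ≤ c * (x k - x l) ^ 2 := by
    calc ∑ i, (x i - 1 / c) ^ 2 ≤ ∑ _i : ι, (x k - x l) ^ 2 := by
          refine Finset.sum_le_sum fun i _ => sq_le_sq' ?_ ?_
          · linarith [hl' i]
          · linarith [hk' i]
      _ = _ := by rw [Finset.sum_const, Finset.card_univ, nsmul_eq_mul, ← hc]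
  have hn' : (2 : ℝ) ≤ n := by exact_mod_cast hn
  refine le_trans ?_ (sum_visibleRatio_ge hx hx1 (by omega) k l (hl' k))
  obtain ⟨d, rfl⟩ : ∃ d, n = d + 1 := ⟨n - 1, by omega⟩
  rw [mul_assoc]
  refine mul_le_mul_of_nonneg_left ?_ (by linarith)
  have hpow : (x k - x l) * (1 / c) ^ d ≤ x k ^ (d + 1) - x l ^ (d + 1) := by
    have h1 : (1 / c) ^ d ≤ x k ^ d := pow_le_pow_left₀ (by positivity) hmax d
    have h2 : x l ^ d ≤ x k ^ d := pow_le_pow_left₀ (hx l).le (hl' k) d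
    have h3 := mul_le_mul_of_nonneg_left h1 (sub_nonneg.2 (hl' k))
    have h4 := mul_le_mul_of_nonneg_left h2 (hx l).le
    rw [pow_succ, pow_succ]
    linarith
  calc (1 / c) ^ (d + 1) * ∑ i, (x i - 1 / c) ^ 2
      ≤ (1 / c) ^ (d + 1) * (c * (x k - x l) ^ 2) :=
        mul_le_mul_of_nonneg_left hsq (by positivity)
    _ = (x k - x l) * ((x k - x l) * (1 / c) ^ d) := by
        rw [pow_succ]; field_simp
    _ ≤ _ := mul_le_mul_of_nonneg_left hpow (sub_nonneg.2 (hl' k))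

end TypeWord

/-! ### Convergence of almost supermartingales -/

/-- The **Robbins–Siegmund** almost supermartingale convergence theorem, with deterministic
summable errors. -/
theorem ae_tendsto_and_summable_of_almost_supermartingale {Ω : Type*} {mΩ : MeasurableSpace Ω}
    {μ : Measure Ω} [IsFiniteMeasure μ] {ℱ : Filtration ℕ mΩ} {X D : ℕ → Ω → ℝ} {e : ℕ → ℝ}
    (hX : StronglyAdapted ℱ X) (hD : StronglyAdapted ℱ D)
    (hXi : ∀ t, Integrable (X t) μ) (hDi : ∀ t, Integrable (D t) μ)
    (hX0 : ∀ t, 0 ≤ᵐ[μ] X t) (hD0 : ∀ t, 0 ≤ᵐ[μ] D t)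
    (he0 : ∀ t, 0 ≤ e t) (he : Summable e)
    (h : ∀ t, μ[X (t + 1) | ℱ t] ≤ᵐ[μ] fun ω => X t ω - D t ω + e t) :
    ∀ᵐ ω ∂μ, (∃ L, Tendsto (fun t => X t ω) atTop (𝓝 L)) ∧ Summable fun t => D t ω := by
  set A : ℕ → Ω → ℝ := fun t ω => ∑ s ∈ Finset.range t, (D s ω - e s) with hA
  set Z : ℕ → Ω → ℝ := fun t => X t + A t with hZ
  -- The compensator `A` is predictable, so it passes through the conditional expectation and `X +
  -- A` is a supermartingale.
  have hAm : ∀ t, StronglyMeasurable[ℱ t] (A (t + 1)) := by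
    intro t
    refine Finset.stronglyMeasurable_fun_sum _ fun s hs => ?_
    have hst : s ≤ t := by simpa [Nat.lt_succ_iff] using hs
    exact ((hD s).mono (ℱ.mono hst)).sub stronglyMeasurable_const
  have hAm' : ∀ t, StronglyMeasurable[ℱ t] (A t) := by
    intro t
    refine Finset.stronglyMeasurable_fun_sum _ fun s hs => ?_
    exact ((hD s).mono (ℱ.mono (Finset.mem_range.1 hs).le)).sub stronglyMeasurable_const
  have hAi : ∀ t, Integrable (A t) μ := fun t =>
    integrable_finsetSum _ fun s _ => (hDi s).sub (integrable_const _)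
  have hsuper : Supermartingale Z ℱ μ := by
    refine supermartingale_nat (fun t => (hX t).add (hAm' t)) (fun t => (hXi t).add (hAi t)) ?_
    intro t
    have h1 := condExp_add (hXi (t + 1)) (hAi (t + 1)) (ℱ t)
    rw [condExp_of_stronglyMeasurable (ℱ.le t) (hAm t) (hAi (t + 1))] at h1
    filter_upwards [h1, h t] with ω h1 h2
    rw [h1]
    simp only [hZ, hA, Pi.add_apply, Finset.sum_range_succ] at h2 ⊢
    linarith
  set E : ℝ := ∑' t, e t with hE
  have hE0 : 0 ≤ E := tsum_nonneg he0
  have hsumE : ∀ t, ∑ s ∈ Finset.range t, e s ≤ E := fun t =>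
    he.sum_le_tsum _ fun s _ => he0 s
  have hlow : ∀ t, ∀ᵐ ω ∂μ, -E ≤ Z t ω := by
    intro t
    filter_upwards [hX0 t, ae_all_iff.2 hD0] with ω h1 h2
    have h3 : 0 ≤ ∑ s ∈ Finset.range t, D s ω := Finset.sum_nonneg fun s _ => h2 s
    have h4 := hsumE t
    simp only [hZ, hA, Pi.add_apply, Finset.sum_sub_distrib, Pi.zero_apply] at h1 ⊢
    linarith
  -- From `Z ≥ -E` comes `|Z| ≤ Z + 2 * E`, and the mean of `Z` is at most its initial value.
  have hbdd : ∀ t, eLpNorm ((-Z) t) 1 μ ≤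
      (Real.toNNReal (∫ ω, Z 0 ω ∂μ + 2 * E * μ.real Set.univ) : NNReal) := by
    intro t
    have hint := hsuper.integrable t
    rw [Pi.neg_apply, eLpNorm_neg, eLpNorm_one_eq_lintegral_enorm,
      ← ofReal_integral_norm_eq_lintegral_enorm hint]
    refine ENNReal.ofReal_le_ofReal ?_
    have h1 : ∫ ω, ‖Z t ω‖ ∂μ ≤ ∫ ω, (Z t ω + 2 * E) ∂μ := by
      refine integral_mono_ae hint.norm (hint.add (integrable_const _)) ?_
      filter_upwards [hlow t] with ω hω
      rw [Real.norm_eq_abs, abs_le]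
      constructor <;> linarith
    have h2 : ∫ ω, Z t ω ∂μ ≤ ∫ ω, Z 0 ω ∂μ := by
      simpa using hsuper.setIntegral_le (Nat.zero_le t) MeasurableSet.univ
    rw [integral_add hint (integrable_const _), integral_const, smul_eq_mul] at h1
    linarith
  have hconv := hsuper.neg.ae_tendsto_limitProcess hbdd
  filter_upwards [hconv, ae_all_iff.2 hX0, ae_all_iff.2 hD0] with ω hω hx hd
  have hZlim : Tendsto (fun t => Z t ω) atTop
      (𝓝 (-(Filtration.limitProcess (-Z) ℱ μ ω))) := by
    simpa using hω.neg
  obtain ⟨B, hB⟩ := hZlim.bddAbove_range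
  have hDs : Summable fun t => D t ω := by
    refine summable_of_sum_range_le (c := B + E) hd fun t => ?_
    have h1 : Z t ω ≤ B := hB ⟨t, rfl⟩
    have h2 := hsumE t
    have h3 := hx t
    simp only [hZ, hA, Pi.add_apply, Finset.sum_sub_distrib, Pi.zero_apply] at h1 h3
    linarith
  have hAlim := (hDs.sub he).hasSum.tendsto_sum_nat
  refine ⟨⟨_, (hZlim.sub hAlim).congr fun t => ?_⟩, hDs⟩
  simp [hZ, hA]

/-! ### Markov chains confined to finite sets at each time -/

section Chain

variable {Ω S : Type*} {mΩ : MeasurableSpace Ω} {μ : Measure Ω} [IsProbabilityMeasure μ]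
  {ℱ : Filtration ℕ mΩ} [MeasurableSpace S] [DiscreteMeasurableSpace S]
  {κ : S → PMF S} {R : ℕ → Set S} {G : ℕ → Ω → S}

theorem ae_mem_of_condExp_eq [Countable S] (hR : ∀ t, ∀ x ∈ R t, ∀ y, y ∉ R (t + 1) → κ x y = 0)
    (hG : ∀ t, Measurable[ℱ t] (G t)) (h0 : ∀ᵐ ω ∂μ, G 0 ω ∈ R 0)
    (hstep : ∀ (t : ℕ) (y : S), μ[({ω | G (t + 1) ω = y}).indicator (fun _ => (1 : ℝ)) | ℱ t]
      =ᵐ[μ] fun ω => (κ (G t ω) y).toReal) :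
    ∀ᵐ ω ∂μ, ∀ t, G t ω ∈ R t := by
  rw [ae_all_iff]
  intro t
  induction t with
  | zero => exact h0
  | succ t ih =>
    have hne : ∀ y, y ∉ R (t + 1) → ∀ᵐ ω ∂μ, G (t + 1) ω ≠ y := by
      intro y hy
      have hms : MeasurableSet {ω | G (t + 1) ω = y} :=
        (ℱ.le (t + 1)) _ (hG (t + 1) (MeasurableSet.singleton y))
      have h1 : ∫ ω, ({ω | G (t + 1) ω = y}).indicator (fun _ => (1 : ℝ)) ω ∂μ = 0 := by
        rw [← integral_condExp (ℱ.le t)]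
        refine integral_eq_zero_of_ae ?_
        filter_upwards [hstep t y, ih] with ω h1 h2
        rw [h1, hR t _ h2 y hy]
        rfl
      rw [integral_indicator_const _ hms, smul_eq_mul, mul_one, measureReal_eq_zero_iff] at h1
      rw [ae_iff]
      simpa using h1
    have hall : ∀ᵐ ω ∂μ, ∀ y, y ∉ R (t + 1) → G (t + 1) ω ≠ y := by
      rw [ae_all_iff]
      intro y
      by_cases hy : y ∈ R (t + 1)
      · exact ae_of_all _ fun ω h => absurd hy h
      · filter_upwards [hne y hy] with ω hω _ using hω
    filter_upwards [hall] with ω hω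
    by_contra hcon
    exact hω _ hcon rfl

theorem integrable_comp_of_ae_mem (hfin : ∀ t, (R t).Finite)
    (hG : ∀ t, Measurable[ℱ t] (G t)) (hmem : ∀ᵐ ω ∂μ, ∀ t, G t ω ∈ R t) (f : S → ℝ) (t : ℕ) :
    Integrable (fun ω => f (G t ω)) μ := by
  obtain ⟨C, hC⟩ := ((hfin t).image fun x => ‖f x‖).bddAbove
  refine Integrable.of_bound (C := C) ?_ ?_
  · exact ((Measurable.of_discrete (f := f)).comp
      ((hG t).mono (ℱ.le t) le_rfl)).aestronglyMeasurable
  · filter_upwards [hmem] with ω hω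
    exact hC ⟨_, hω t, rfl⟩

/-- Almost surely `f (G (t + 1))` is a finite combination of indicators of single states, so
linearity extends the transition rule from states to functions. -/
theorem condExp_comp_eq_sum (hfin : ∀ t, (R t).Finite)
    (hG : ∀ t, Measurable[ℱ t] (G t)) (hmem : ∀ᵐ ω ∂μ, ∀ t, G t ω ∈ R t)
    (hstep : ∀ (t : ℕ) (y : S), μ[({ω | G (t + 1) ω = y}).indicator (fun _ => (1 : ℝ)) | ℱ t]
      =ᵐ[μ] fun ω => (κ (G t ω) y).toReal) (f : S → ℝ) (t : ℕ) :
    μ[fun ω => f (G (t + 1) ω) | ℱ t] =ᵐ[μ]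
      fun ω => ∑ y ∈ (hfin (t + 1)).toFinset, f y * (κ (G t ω) y).toReal := by
  classical
  have h1 : (fun ω => f (G (t + 1) ω)) =ᵐ[μ] ∑ y ∈ (hfin (t + 1)).toFinset,
      f y • ({ω | G (t + 1) ω = y}).indicator (fun _ => (1 : ℝ)) := by
    filter_upwards [hmem] with ω hω
    rw [Finset.sum_apply, Finset.sum_eq_single (G (t + 1) ω)]
    · simp
    · intro y _ hy
      simp [Ne.symm hy]
    · intro hn
      exact absurd ((hfin (t + 1)).mem_toFinset.2 (hω (t + 1))) hn
  have hms : ∀ y, MeasurableSet {ω | G (t + 1) ω = y} := fun y =>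
    (ℱ.le (t + 1)) _ (hG (t + 1) (MeasurableSet.singleton y))
  refine (condExp_congr_ae h1).trans ?_
  refine (condExp_finsetSum (fun y _ =>
    ((integrable_const (1 : ℝ)).indicator (hms y)).smul (f y)) _).trans ?_
  have h2 : ∀ᵐ ω ∂μ, ∀ y ∈ (hfin (t + 1)).toFinset,
      (μ[f y • ({ω | G (t + 1) ω = y}).indicator (fun _ => (1 : ℝ)) | ℱ t]) ω =
        f y * (κ (G t ω) y).toReal := by
    rw [Finset.eventually_all]
    intro y _
    filter_upwards [condExp_smul (μ := μ) (f y)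
      (({ω | G (t + 1) ω = y}).indicator (fun _ => (1 : ℝ))) (ℱ t), hstep t y] with ω h3 h4
    rw [h3, Pi.smul_apply, h4, smul_eq_mul]
  filter_upwards [h2] with ω hω
  rw [Finset.sum_apply]
  exact Finset.sum_congr rfl hω

end Chain

/-! ### Effect and mean of one attachment step -/

namespace TypedGraph

variable {N : ℕ}

instance : DiscreteMeasurableSpace (TypedGraph N) := ⟨fun _ => trivial⟩

instance : Countable (TypedGraph N) := by
  have : Function.Injective (fun G : TypedGraph N =>
      (⟨G.n, G.edges, G.type⟩ : Σ n, Multiset (Sym2 (Fin n)) × (Fin n → Fin N))) := by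
    rintro ⟨n, e, he, ty⟩ ⟨n', e', he', ty'⟩ h
    simp only [Sigma.mk.injEq] at h
    obtain ⟨rfl, h⟩ := h
    simp only [heq_eq_eq, Prod.mk.injEq] at h
    obtain ⟨rfl, rfl⟩ := h
    rfl
  have : Countable (Σ n, Multiset (Sym2 (Fin n)) × (Fin n → Fin N)) := by
    have : ∀ n, Countable (Sym2 (Fin n)) := fun n => inferInstance
    infer_instance
  exact Function.Injective.countable ‹_›

/-- The total degree of the vertices of a given type. -/
def typeDegree (G : TypedGraph N) (i : Fin N) : ℕ := ∑ v with G.type v = i, G.degree v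

/-- The number of vertices of a given type. -/
def typeCount (G : TypedGraph N) (i : Fin N) : ℕ := (Finset.univ.filter fun v => G.type v = i).card

theorem degreeProportion_eq (G : TypedGraph N) (i : Fin N) :
    G.degreeProportion i = G.typeDegree i / G.totalDegree := by
  simp [degreeProportion, typeDegree]

theorem sum_typeDegree (G : TypedGraph N) : ∑ i, G.typeDegree i = G.totalDegree :=
  Finset.sum_fiberwise _ _ _

theorem sum_degreeProportion (G : TypedGraph N) : ∑ i, G.degreeProportion i = 1 := by
  simp_rw [degreeProportion_eq]
  rw [← Finset.sum_div, ← Nat.cast_sum, sum_typeDegree]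
  exact div_self (by exact_mod_cast G.totalDegree_pos.ne')

/-- The multiset of types of edge-ends lives over the fixed set `Fin N`, so graphs with different
vertex sets can be compared. -/
theorem typeDegree_eq_count (G : TypedGraph N) (i : Fin N) :
    G.typeDegree i = (G.edgeEnds.map G.type).count i := by
  have h : ∀ v, (G.edgeEnds.filter fun v => i = G.type v).count v =
      if G.type v = i then G.degree v else 0 := by
    intro v
    rw [Multiset.count_filter, degree]
    simp only [eq_comm]
  rw [Multiset.count_map, typeDegree, Finset.sum_filter]
  simp_rw [← h]
  exact Multiset.sum_count_eq_card fun a _ => Finset.mem_univ a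

theorem toMultiset_sym2Map {α β : Type*} (f : α → β) (e : Sym2 α) :
    (Sym2.map f e).toMultiset = e.toMultiset.map f := by
  induction e with
  | h a b => simp [Sym2.toMultiset]

section addVertex

variable (G : TypedGraph N) {m : ℕ} (w : Fin m → Fin G.n) (c : Fin N)

theorem typeDegree_addVertex (i : Fin N) :
    (G.addVertex w c).typeDegree i =
      G.typeDegree i + TypeWord.occ (fun j => G.type (w j)) i + if c = i then m else 0 := by
  have hends : (G.addVertex w c).edgeEnds.map (G.addVertex w c).type =
      G.edgeEnds.map G.type +
        (Finset.univ : Finset (Fin m)).val.bind fun j => {G.type (w j), c} := by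
    change Multiset.map (Fin.snoc G.type c) (Multiset.bind (_ + _) Sym2.toMultiset) = _
    rw [Multiset.add_bind, Multiset.map_add, Multiset.bind_map, Multiset.bind_map,
      Multiset.map_bind, Multiset.map_bind, edgeEnds, Multiset.map_bind]
    congr 1
    · refine Multiset.bind_congr fun e _ => ?_
      rw [toMultiset_sym2Map, Multiset.map_map]
      refine Multiset.map_congr rfl fun v _ => ?_
      simp
    · refine Multiset.bind_congr fun j _ => ?_
      simp [Sym2.toMultiset]
      rfl
  rw [typeDegree_eq_count, hends, Multiset.count_add, ← typeDegree_eq_count, add_assoc]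
  congr 1
  rw [Multiset.count_bind, TypeWord.occ, Finset.card_filter]
  change ∑ j, _ = _
  have : ∀ j, Multiset.count i {G.type (w j), c} =
      (if G.type (w j) = i then 1 else 0) + if c = i then 1 else 0 := by
    intro j
    rw [Multiset.insert_eq_cons, Multiset.count_cons, Multiset.count_singleton, add_comm]
    simp only [eq_comm]
  simp_rw [this]
  rw [Finset.sum_add_distrib]
  simp

theorem totalDegree_addVertex : (G.addVertex w c).totalDegree = G.totalDegree + 2 * m := by
  rw [totalDegree_eq, totalDegree_eq]
  simp [addVertex, mul_add]

theorem typeCount_addVertex (i : Fin N) :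
    (G.addVertex w c).typeCount i = G.typeCount i + if c = i then 1 else 0 := by
  unfold typeCount
  rw [Finset.card_filter, Finset.card_filter]
  change ∑ v : Fin (G.n + 1), _ = _
  rw [Fin.sum_univ_castSucc]
  simp [addVertex]

end addVertex

/-- The expectation of a function of the neighbours and the type of the new vertex. -/
def stepMean (G : TypedGraph N) (m : ℕ) (F : (Fin m → Fin G.n) → Fin N → ℝ) : ℝ :=
  ∑ w : Fin m → Fin G.n, (∏ j, (G.degree (w j) / G.totalDegree : ℝ)) *
    ((∑ c ∈ G.visibleTypes w, F w c) * ((G.visibleTypes w).card : ℝ)⁻¹)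

theorem stepMean_mono (G : TypedGraph N) {m : ℕ} {F F' : (Fin m → Fin G.n) → Fin N → ℝ}
    (h : ∀ w c, F w c ≤ F' w c) : G.stepMean m F ≤ G.stepMean m F' := by
  unfold stepMean
  refine Finset.sum_le_sum fun w _ => mul_le_mul_of_nonneg_left ?_
    (Finset.prod_nonneg fun j _ => by positivity)
  exact mul_le_mul_of_nonneg_right (Finset.sum_le_sum fun c _ => h w c) (by positivity)

theorem stepMean_sum (G : TypedGraph N) {m : ℕ} {ι : Type*} (s : Finset ι)
    (F : ι → (Fin m → Fin G.n) → Fin N → ℝ) :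
    G.stepMean m (fun w c => ∑ i ∈ s, F i w c) = ∑ i ∈ s, G.stepMean m (F i) := by
  unfold stepMean
  rw [Finset.sum_comm]
  refine Finset.sum_congr rfl fun w _ => ?_
  rw [Finset.sum_comm, Finset.sum_mul, Finset.mul_sum]

/-- Grouping neighbour tuples by their type word makes the degree weights factor into degree
proportions: the step sees the graph only through these. -/
theorem stepMean_type (G : TypedGraph N) {m : ℕ} (F : (Fin m → Fin N) → Fin N → ℝ) :
    G.stepMean m (fun w c => F (fun j => G.type (w j)) c) =
      ∑ u : Fin m → Fin N, TypeWord.weight G.degreeProportion u *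
        ((∑ c ∈ TypeWord.letters u, F u c) * ((TypeWord.letters u).card : ℝ)⁻¹) := by
  unfold stepMean
  rw [← Finset.sum_fiberwise (Finset.univ) (fun (w : Fin m → Fin G.n) j => G.type (w j))]
  refine Finset.sum_congr rfl fun u _ => ?_
  have h1 : ∀ w ∈ Finset.univ.filter (fun w : Fin m → Fin G.n => (fun j => G.type (w j)) = u),
      (∏ j, (G.degree (w j) / G.totalDegree : ℝ)) *
        ((∑ c ∈ G.visibleTypes w, F (fun j => G.type (w j)) c) *
          ((G.visibleTypes w).card : ℝ)⁻¹) =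
      (∏ j, (G.degree (w j) / G.totalDegree : ℝ)) *
        ((∑ c ∈ TypeWord.letters u, F u c) * ((TypeWord.letters u).card : ℝ)⁻¹) := by
    intro w hw
    obtain rfl := (Finset.mem_filter.1 hw).2
    rfl
  rw [Finset.sum_congr rfl h1, ← Finset.sum_mul]
  congr 1
  have h2 : Finset.univ.filter (fun w : Fin m → Fin G.n => (fun j => G.type (w j)) = u) =
      Fintype.piFinset fun j => Finset.univ.filter fun v => G.type v = u j := by
    ext w
    simp [funext_iff]
  rw [h2, ← Finset.prod_univ_sum (fun j => Finset.univ.filter fun v => G.type v = u j)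
    (fun _ v => (G.degree v / G.totalDegree : ℝ)), TypeWord.weight]
  refine Finset.prod_congr rfl fun j _ => ?_
  rw [degreeProportion, Finset.sum_div]

/-- The mean of a function that is affine in the number of neighbours of type `i` and in the
indicator that the new vertex has type `i`. -/
theorem stepMean_affine (G : TypedGraph N) {m : ℕ} (hm : 0 < m) (i : Fin N) (a b d : ℝ) :
    G.stepMean m (fun w c => a + b * (TypeWord.occ (fun j => G.type (w j)) i : ℝ) +
      d * if c = i then 1 else 0) =
      a + b * (m * G.degreeProportion i) +
        d * TypeWord.visibleProb G.degreeProportion m i := by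
  rw [G.stepMean_type fun u c => a + b * (TypeWord.occ u i : ℝ) + d * if c = i then 1 else 0]
  rw [← TypeWord.sum_weight_mul_occ G.sum_degreeProportion, TypeWord.visibleProb,
    Finset.mul_sum, Finset.mul_sum]
  have ha : a = ∑ u : Fin m → Fin N, TypeWord.weight G.degreeProportion u * a := by
    rw [← Finset.sum_mul, TypeWord.sum_weight G.sum_degreeProportion, one_mul]
  conv_rhs => rw [ha]
  rw [← Finset.sum_add_distrib, ← Finset.sum_add_distrib]
  refine Finset.sum_congr rfl fun u _ => ?_
  have hne : ((TypeWord.letters u).card : ℝ) ≠ 0 := by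
    have : (TypeWord.letters u).Nonempty := ⟨u ⟨0, hm⟩, TypeWord.mem_letters.2 ⟨_, rfl⟩⟩
    exact_mod_cast this.card_pos.ne'
  rw [Finset.sum_add_distrib, Finset.sum_const, nsmul_eq_mul, ← Finset.mul_sum,
    Finset.sum_ite_eq']
  split_ifs
  · field_simp
  · field_simp
    ring

theorem toReal_preferentialVertex (G : TypedGraph N) (v : Fin G.n) :
    (G.preferentialVertex v).toReal = G.degree v / G.totalDegree := by
  simp [preferentialVertex]

theorem toReal_visibleStep (G : TypedGraph N) {m : ℕ} (hm : 0 < m) (H : TypedGraph N) :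
    (G.visibleStep m hm H).toReal =
      open Classical in G.stepMean m (fun w c => if G.addVertex w c = H then 1 else 0) := by
  classical
  rw [visibleStep, PMF.bind_apply, tsum_fintype, ENNReal.toReal_sum
    fun w _ => ENNReal.mul_ne_top (PMF.apply_ne_top _ _) (PMF.apply_ne_top _ _), stepMean]
  refine Finset.sum_congr rfl fun w _ => ?_
  rw [ENNReal.toReal_mul]
  congr 1
  · simp [neighbours, ENNReal.toReal_prod, toReal_preferentialVertex]
  · have hc : ∀ c, (if H = G.addVertex w c then PMF.uniformOfFinset (G.visibleTypes w)
        (G.visibleTypes_nonempty hm w) c else 0).toReal =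
        if c ∈ G.visibleTypes w then
          (if G.addVertex w c = H then 1 else 0) * ((G.visibleTypes w).card : ℝ)⁻¹ else 0 := by
      intro c
      by_cases h1 : H = G.addVertex w c
      · by_cases h2 : c ∈ G.visibleTypes w <;> simp [h1, h2]
      · simp [h1, Ne.symm h1]
    rw [PMF.map_apply, tsum_fintype, ENNReal.toReal_sum, Finset.sum_mul]
    · simp_rw [hc]
      rw [Finset.sum_ite_mem, Finset.univ_inter]
    · intro c _
      split_ifs
      · exact PMF.apply_ne_top _ _
      · exact ENNReal.zero_ne_top

theorem sum_mul_visibleStep (G : TypedGraph N) {m : ℕ} (hm : 0 < m) (R : Finset (TypedGraph N))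
    (hR : ∀ w c, G.addVertex (m := m) w c ∈ R) (f : TypedGraph N → ℝ) :
    ∑ H ∈ R, f H * (G.visibleStep m hm H).toReal =
      G.stepMean m (fun w c => f (G.addVertex w c)) := by
  classical
  have h : ∀ H, f H * (G.visibleStep m hm H).toReal =
      G.stepMean m (fun w c => if G.addVertex w c = H then f H else 0) := by
    intro H
    rw [toReal_visibleStep, stepMean, stepMean, Finset.mul_sum]
    refine Finset.sum_congr rfl fun w _ => ?_
    have : ∑ c ∈ G.visibleTypes w, (if G.addVertex w c = H then f H else 0) =
        f H * ∑ c ∈ G.visibleTypes w, (if G.addVertex w c = H then 1 else 0) := by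
      rw [Finset.mul_sum]
      exact Finset.sum_congr rfl fun c _ => by simp
    rw [this]
    ring
  simp_rw [h]
  rw [← stepMean_sum]
  congr 1
  funext w c
  simp [hR]

theorem visibleStep_eq_zero (G : TypedGraph N) {m : ℕ} (hm : 0 < m) (H : TypedGraph N)
    (hH : ∀ w c, G.addVertex (m := m) w c ≠ H) : G.visibleStep m hm H = 0 := by
  have h : (G.visibleStep m hm H).toReal = 0 := by
    rw [toReal_visibleStep, stepMean]
    simp [hH]
  exact (ENNReal.toReal_eq_zero_iff _).1 h |>.resolve_right (PMF.apply_ne_top _ _)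

end TypedGraph

/-! ### Affine one-step bounds for the three terms of the potential -/

/-- The bound is affine in `Δ`, so its mean is explicit. With `z = Δ / Y ≤ 2 * M / Y`, it uses `log
(1 + z) ≥ 2 * z / (z + 2) ≥ z * (1 - M / Y)`. -/
theorem neg_log_add_div_le {Y T Δ M c : ℝ} (hc : 0 < c) (hY : 0 < Y) (hT : 0 < T) (hΔ : 0 ≤ Δ)
    (hΔM : Δ ≤ 2 * M) :
    -Real.log (c * ((Y + Δ) / (T + 2 * M))) ≤
      -Real.log (c * (Y / T)) + 2 * M / T - Δ * ((1 - M / Y) / Y) := by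
  have hM : 0 ≤ M := by linarith
  have e1 : c * ((Y + Δ) / (T + 2 * M)) = c * (Y / T) * (1 + Δ / Y) / (1 + 2 * M / T) := by
    field_simp
  have hz : 0 ≤ Δ / Y := by positivity
  rw [e1, Real.log_div (by positivity) (by positivity), Real.log_mul (by positivity)
    (by positivity)]
  have h1 : Real.log (1 + 2 * M / T) ≤ 2 * M / T := by
    have := Real.log_le_sub_one_of_pos (show (0 : ℝ) < 1 + 2 * M / T by positivity)
    linarith
  have h2 := Real.le_log_one_add_of_nonneg hz
  have h3 : Δ * ((1 - M / Y) / Y) ≤ 2 * (Δ / Y) / (Δ / Y + 2) := by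
    rw [le_div_iff₀ (by positivity)]
    have e2 : Δ * ((1 - M / Y) / Y) = Δ / Y * (1 - M / Y) := by ring
    have h4 : Δ / Y ≤ 2 * (M / Y) := by
      rw [← mul_div_assoc]; gcongr
    rw [e2]
    set z := Δ / Y
    have h5 : 0 ≤ M / Y := by positivity
    nlinarith [mul_nonneg hz h5, mul_nonneg hz (sub_nonneg.2 h4), mul_nonneg (mul_nonneg hz hz) h5]
  linarith

theorem inv_add_le {Y Δ M : ℝ} (hY : 0 < Y) (hΔ : 0 ≤ Δ) (hΔM : Δ ≤ 2 * M) :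
    (Y + Δ)⁻¹ ≤ Y⁻¹ - Δ * (Y * (Y + 2 * M))⁻¹ := by
  have e : (Y + Δ)⁻¹ = Y⁻¹ - Δ * (Y * (Y + Δ))⁻¹ := by
    field_simp
    ring
  rw [e]
  gcongr

theorem sq_div_le {T β K M a : ℝ} (hT : 0 < T) (hM : 0 ≤ M) (h : (K - a) ^ 2 ≤ M ^ 2) :
    ((T * β + (K - a)) / (T + 2 * M)) ^ 2 ≤
      (T ^ 2 * β ^ 2 + M ^ 2 - 2 * T * β * a) / (T + 2 * M) ^ 2 +
        K * (2 * T * β / (T + 2 * M) ^ 2) := by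
  rw [div_pow, mul_div_assoc', ← add_div]
  gcongr
  nlinarith

/-- The cross term is split by `2 * β * y ≤ β ^ 2 + y ^ 2`; the growth of the denominator leaves a
net contraction of `β ^ 2`. -/
theorem mean_sq_le {T β M y : ℝ} (hT : 2 ≤ T) (hM : 1 ≤ M) :
    (T ^ 2 * β ^ 2 + M ^ 2 + 2 * T * β * (M * y)) / (T + 2 * M) ^ 2 ≤
      β ^ 2 - β ^ 2 / (2 * T) + M * y ^ 2 / T + M ^ 2 / T ^ 2 := by
  have hT' : 0 < T + 2 * M := by linarith
  have h1 : T ^ 2 * β ^ 2 + M ^ 2 + 2 * T * β * (M * y) ≤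
      ((T + 2 * M) ^ 2 - M * (T + 2 * M)) * β ^ 2 + M * T * y ^ 2 + M ^ 2 := by
    have : 0 ≤ M * T * (β - y) ^ 2 := by positivity
    nlinarith [mul_nonneg (show 0 ≤ M * T by positivity) (sq_nonneg β),
      mul_nonneg (show 0 ≤ M * M by positivity) (sq_nonneg β)]
  have h2 : ((T + 2 * M) ^ 2 - M * (T + 2 * M)) * β ^ 2 / (T + 2 * M) ^ 2 ≤
      β ^ 2 - β ^ 2 / (2 * T) := by
    have e : ((T + 2 * M) ^ 2 - M * (T + 2 * M)) * β ^ 2 / (T + 2 * M) ^ 2 =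
        β ^ 2 - β ^ 2 * (M / (T + 2 * M)) := by
      field_simp
    have h3 : 1 / (2 * T) ≤ M / (T + 2 * M) := by
      rw [div_le_div_iff₀ (by linarith) hT']
      nlinarith
    have h4 := mul_le_mul_of_nonneg_left h3 (sq_nonneg β)
    rw [e, div_eq_mul_one_div (β ^ 2) (2 * T)]
    linarith
  have h3 : M * T * y ^ 2 / (T + 2 * M) ^ 2 ≤ M * y ^ 2 / T := by
    rw [div_le_div_iff₀ (by positivity) (by linarith)]
    have : T * T ≤ (T + 2 * M) ^ 2 := by nlinarith
    have := mul_le_mul_of_nonneg_left this (show 0 ≤ M * y ^ 2 by positivity)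
    nlinarith
  have h4 : M ^ 2 / (T + 2 * M) ^ 2 ≤ M ^ 2 / T ^ 2 := by
    gcongr
    linarith
  calc _ ≤ (((T + 2 * M) ^ 2 - M * (T + 2 * M)) * β ^ 2 + M * T * y ^ 2 + M ^ 2) /
        (T + 2 * M) ^ 2 := by gcongr
    _ ≤ _ := by
      rw [add_div, add_div]
      linarith

/-! ### The Lyapunov function and its drift -/

namespace TypedGraph

variable {N : ℕ}

/-- The deviation from `1 / (2 * N)` of the proportion of edge-ends which lie at vertices of type
`i` and are not the ends created together with their vertex. -/
def oldEndsDeviation (m : ℕ) (G : TypedGraph N) (i : Fin N) : ℝ :=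
  (G.typeDegree i - m * G.typeCount i) / G.totalDegree - 1 / (2 * N)

/-- The contribution of type `i` to the Lyapunov function. -/
def typePotential (ε : ℝ) (m : ℕ) (G : TypedGraph N) (i : Fin N) : ℝ :=
  -Real.log (N * G.degreeProportion i) + (1 + 2 * m) * (m + 1) * (G.typeDegree i : ℝ)⁻¹ +
    ε * G.oldEndsDeviation m i ^ 2

/-- The Lyapunov function. -/
def potential (ε : ℝ) (m : ℕ) (G : TypedGraph N) : ℝ := ∑ i, G.typePotential ε m i

/-- The rate at which the Lyapunov function decreases on average. -/
def decayRate (ε : ℝ) (m : ℕ) (G : TypedGraph N) : ℝ :=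
  ∑ i, (m * ε * (G.degreeProportion i - 1 / N) ^ 2 + m * (G.typeDegree i : ℝ)⁻¹ +
    ε / 2 * G.oldEndsDeviation m i ^ 2)

theorem stepMean_typePotential_le [NeZero N] (G : TypedGraph N) {n : ℕ} {ε : ℝ} (hε : 0 ≤ ε)
    (i : Fin N) (hi : 1 ≤ G.typeDegree i) :
    G.stepMean (n + 1) (fun w c => (G.addVertex w c).typePotential ε (n + 1) i) ≤
      G.typePotential ε (n + 1) i +
        ((n + 1 : ℕ) * (1 - TypeWord.visibleRatio G.degreeProportion n i)
          - (n + 1 : ℕ) * (G.typeDegree i : ℝ)⁻¹ - ε / 2 * G.oldEndsDeviation (n + 1) i ^ 2 +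
          (n + 1 : ℕ) * ε * (G.degreeProportion i - 1 / N) ^ 2) / G.totalDegree +
        ε * (n + 1 : ℕ) ^ 2 / (G.totalDegree : ℝ) ^ 2 := by
  have hN : (0 : ℝ) < N := by exact_mod_cast Nat.pos_of_ne_zero (NeZero.ne N)
  have hN1 : (1 : ℝ) ≤ N := by exact_mod_cast Nat.pos_of_ne_zero (NeZero.ne N)
  have hT2 : (2 : ℝ) ≤ G.totalDegree := by
    have h1 := Multiset.card_pos.2 G.edges_ne_zero
    have h2 := G.totalDegree_eq
    have : 2 ≤ G.totalDegree := by omega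
    exact_mod_cast this
  have hY1 : (1 : ℝ) ≤ G.typeDegree i := by exact_mod_cast hi
  set m := n + 1 with hm
  set T : ℝ := (G.totalDegree : ℝ) with hT
  set Y : ℝ := (G.typeDegree i : ℝ) with hY
  set β := G.oldEndsDeviation m i with hβ
  set x := G.degreeProportion i with hx
  set M : ℝ := (m : ℝ) with hM
  set r := TypeWord.visibleRatio G.degreeProportion n i with hr
  have hM1 : 1 ≤ M := by rw [hM, hm]; push_cast; linarith [Nat.cast_nonneg (α := ℝ) n]
  have hT0 : 0 < T := by linarith
  have hY0 : 0 < Y := by linarith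
  have hxY : x = Y / T := G.degreeProportion_eq i
  have hr0 : 0 ≤ r := TypeWord.visibleRatio_nonneg (fun j => by
    rw [degreeProportion_eq]; positivity) n i
  set L : ℝ := (1 + 2 * M) * (M + 1) with hL
  have hL0 : 0 ≤ L := by positivity
  set b : ℝ := -((1 - M / Y) / Y) - L * (Y * (Y + 2 * M))⁻¹ with hb
  set b' : ℝ := ε * (2 * T * β / (T + 2 * M) ^ 2) with hb'
  set a : ℝ := -Real.log (N * x) + 2 * M / T + L * Y⁻¹ +
    ε * ((T ^ 2 * β ^ 2 + M ^ 2 - 2 * T * β * (M / N)) / (T + 2 * M) ^ 2) with ha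
  -- An affine majorant in the number of neighbours of type `i` and the indicator of the new type,
  -- whose mean `stepMean_affine` gives exactly.
  have hpt : ∀ w c, (G.addVertex w c).typePotential ε m i ≤
      a + (b + b') * (TypeWord.occ (fun j : Fin m => G.type (w j)) i : ℝ) +
        (M * b) * if c = i then 1 else 0 := by
    intro w c
    set K : ℝ := (TypeWord.occ (fun j : Fin m => G.type (w j)) i : ℝ) with hK
    set d : ℝ := if c = i then 1 else 0 with hd
    have hK0 : 0 ≤ K := by positivity
    have hKM : K ≤ M := by
      rw [hK, hM]; exact_mod_cast TypeWord.occ_le _ _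
    have hd0 : 0 ≤ d := by rw [hd]; split_ifs <;> norm_num
    have hd1 : d ≤ 1 := by rw [hd]; split_ifs <;> norm_num
    have hΔ0 : 0 ≤ K + M * d := by positivity
    have hΔM : K + M * d ≤ 2 * M := by nlinarith
    have hY' : ((G.addVertex w c).typeDegree i : ℝ) = Y + (K + M * d) := by
      rw [typeDegree_addVertex, hd, hM]
      push_cast
      split_ifs <;> simp [hY, hK, add_assoc]
    have hT' : ((G.addVertex w c).totalDegree : ℝ) = T + 2 * M := by
      rw [totalDegree_addVertex]
      push_cast
      rfl
    have hV' : ((G.addVertex w c).typeCount i : ℝ) = G.typeCount i + d := by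
      rw [typeCount_addVertex, hd]
      push_cast
      rfl
    -- The type of the new vertex cancels: its `m` own ends are offset by the increase of `m *
    -- typeCount`.
    have hβ' : (G.addVertex w c).oldEndsDeviation m i = (T * β + (K - M / N)) / (T + 2 * M) := by
      rw [oldEndsDeviation, hY', hT', hV', hβ, oldEndsDeviation, ← hY, ← hT, ← hM]
      have : T + 2 * M ≠ 0 := by positivity
      field_simp
      ring
    have h1 := neg_log_add_div_le hN hY0 hT0 hΔ0 hΔM
    have h2 := mul_le_mul_of_nonneg_left (inv_add_le hY0 hΔ0 hΔM) hL0
    have hsq : (K - M / N) ^ 2 ≤ M ^ 2 := by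
      have h4 : 0 ≤ M / N := by positivity
      have h5 : M / N ≤ M := div_le_self (by linarith) hN1
      exact sq_le_sq' (by linarith) (by linarith)
    have h3 := mul_le_mul_of_nonneg_left (sq_div_le (β := β) hT0 (by linarith) hsq) hε
    rw [typePotential, degreeProportion_eq, hY', hT', hβ']
    rw [← hxY] at h1
    refine (add_le_add (add_le_add h1 h2) h3).trans_eq ?_
    rw [ha, hb, hb']
    ring
  refine (G.stepMean_mono hpt).trans ?_
  rw [G.stepMean_affine (by omega), hm, TypeWord.visibleProb_eq, ← hm, ← hr, ← hx]
  have hmain : b * (M * x * (1 + r)) ≤ -(M * (1 + r)) / T - M * Y⁻¹ / T := by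
    have e1 : b * (M * x * (1 + r)) = -(M * (1 + r)) / T +
        M * (1 + r) / T * (M / Y - L / (Y + 2 * M)) := by
      rw [hb, hxY]
      have : Y + 2 * M ≠ 0 := by positivity
      field_simp
      ring
    -- This dictates `L = (1 + 2 * M) * (M + 1)`: as `Y ≥ 1`, `Y + 2 * M ≤ (1 + 2 * M) * Y`. Of the
    -- gain `(M + 1) / Y`, `M / Y` cancels the logarithm's error and `1 / Y` remains as decay.
    have h1 : (M + 1) / Y ≤ L / (Y + 2 * M) := by
      rw [div_le_div_iff₀ hY0 (by positivity), hL]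
      have : Y + 2 * M ≤ (1 + 2 * M) * Y := by nlinarith
      nlinarith [mul_le_mul_of_nonneg_left this (show 0 ≤ M + 1 by linarith)]
    have h2 : M / Y - L / (Y + 2 * M) ≤ -Y⁻¹ := by
      rw [add_div] at h1
      rw [← one_div]
      linarith
    have h3 := mul_le_mul_of_nonneg_left h2 (show 0 ≤ M * (1 + r) / T by positivity)
    have h4 : M * Y⁻¹ / T ≤ M * (1 + r) / T * Y⁻¹ := by
      have : 0 ≤ M * r / T * Y⁻¹ := by positivity
      have e2 : M * (1 + r) / T * Y⁻¹ = M * Y⁻¹ / T + M * r / T * Y⁻¹ := by ring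
      linarith
    rw [e1]
    linarith
  have hsq := mul_le_mul_of_nonneg_left
    (mean_sq_le (β := β) (y := x - 1 / N) hT2 hM1) hε
  have e : a + (b + b') * (M * x) + M * b * (x * r) =
      -Real.log (N * x) + L * Y⁻¹ + 2 * M / T + b * (M * x * (1 + r)) +
        ε * ((T ^ 2 * β ^ 2 + M ^ 2 + 2 * T * β * (M * (x - 1 / N))) / (T + 2 * M) ^ 2) := by
    rw [ha, hb']
    ring
  change a + (b + b') * (M * x) + M * b * (x * r) ≤ _
  rw [e, typePotential, ← hY, ← hx, ← hβ, ← hM, ← hL]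
  have e3 : (M * (1 - r) - M * Y⁻¹ - ε / 2 * β ^ 2 + M * ε * (x - 1 / N) ^ 2) / T =
      2 * M / T - M * (1 + r) / T - M * Y⁻¹ / T - ε * (β ^ 2 / (2 * T)) +
        ε * (M * (x - 1 / N) ^ 2 / T) := by
    field_simp
    ring
  rw [e3, mul_div_assoc ε]
  have e4 : -(M * (1 + r)) / T = -(M * (1 + r) / T) := by ring
  rw [e4] at hmain
  linarith

/-- The Lyapunov function decreases on average, up to a summable error. -/
theorem stepMean_potential_le [NeZero N] (G : TypedGraph N) {n : ℕ} (hn : 2 ≤ n)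
    (hG : ∀ i, 1 ≤ G.typeDegree i) {ε : ℝ}
    (hε : ε = ((n : ℝ) - 1) / 8 * (1 / N : ℝ) ^ n) :
    G.stepMean (n + 1) (fun w c => (G.addVertex w c).potential ε (n + 1)) ≤
      G.potential ε (n + 1) - G.decayRate ε (n + 1) / G.totalDegree +
        N * (ε * (n + 1 : ℕ) ^ 2) / (G.totalDegree : ℝ) ^ 2 := by
  have hn' : (2 : ℝ) ≤ n := by exact_mod_cast hn
  have hε0 : 0 ≤ ε := by
    rw [hε]
    exact mul_nonneg (by linarith) (by positivity)
  have hT0 : (0 : ℝ) < G.totalDegree := by exact_mod_cast G.totalDegree_pos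
  have hx : ∀ i, 0 < G.degreeProportion i := by
    intro i
    rw [degreeProportion_eq]
    have : (0 : ℝ) < G.typeDegree i := by exact_mod_cast hG i
    positivity
  have hr := TypeWord.sum_visibleRatio_ge_sq hx G.sum_degreeProportion hn
  rw [Fintype.card_fin] at hr
  unfold potential
  rw [stepMean_sum]
  refine (Finset.sum_le_sum fun i _ =>
    G.stepMean_typePotential_le hε0 i (hG i)).trans ?_
  rw [Finset.sum_add_distrib, Finset.sum_add_distrib, ← Finset.sum_div, Finset.sum_const,
    Finset.card_univ, Fintype.card_fin, nsmul_eq_mul, ← mul_div_assoc, sub_eq_add_neg, ← neg_div]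
  gcongr
  -- `ε` is half the constant of the exchange bound: half of the entropy decrease pays for the
  -- growth of the `β` terms, the other half stays in `decayRate`.
  have h2 : ∑ i, (1 - TypeWord.visibleRatio G.degreeProportion n i) ≤
      -(2 * ε * ∑ i, (G.degreeProportion i - 1 / N) ^ 2) := by
    have e1 : ∑ i, (1 - TypeWord.visibleRatio G.degreeProportion n i) =
        -∑ i, (TypeWord.visibleRatio G.degreeProportion n i - 1) := by
      rw [← Finset.sum_neg_distrib]
      exact Finset.sum_congr rfl fun i _ => by ring
    have e2 : 2 * ε = ((n : ℝ) - 1) / 4 * (1 / N : ℝ) ^ n := by rw [hε]; ring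
    rw [e1, e2]
    linarith
  have h3 := mul_le_mul_of_nonneg_left h2 (Nat.cast_nonneg (α := ℝ) (n + 1))
  rw [decayRate]
  simp only [Finset.sum_add_distrib, Finset.sum_sub_distrib, ← Finset.mul_sum] at h3 ⊢
  nlinarith

end TypedGraph

/-! ### Reachable graphs and what the potential controls -/

theorem tendsto_zero_of_mul_le {α : Type*} {l : Filter α} {f g : α → ℝ} {c : ℝ} (hc : 0 < c)
    (hf : ∀ᶠ a in l, 0 ≤ f a) (h : ∀ᶠ a in l, c * f a ≤ g a) (hg : Tendsto g l (𝓝 0)) :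
    Tendsto f l (𝓝 0) := by
  have hg' := hg.const_mul c⁻¹
  rw [mul_zero] at hg'
  refine squeeze_zero' hf (h.mono fun a ha => ?_) hg'
  rw [← div_eq_inv_mul, le_div_iff₀ hc]
  linarith

theorem tendsto_zero_of_sq {α : Type*} {l : Filter α} {f : α → ℝ}
    (h : Tendsto (fun a => f a ^ 2) l (𝓝 0)) : Tendsto f l (𝓝 0) := by
  have h1 := h.sqrt
  simp only [Real.sqrt_sq_eq_abs, Real.sqrt_zero] at h1
  exact (tendsto_zero_iff_abs_tendsto_zero f).2 h1

namespace TypedGraph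

variable {N : ℕ}

/-- The graphs that can arise from `G₀` after `t` steps. -/
def reachable (G₀ : TypedGraph N) (m : ℕ) : ℕ → Set (TypedGraph N)
  | 0 => {G₀}
  | t + 1 => {H | ∃ G ∈ reachable G₀ m t, ∃ w c, G.addVertex (m := m) w c = H}

theorem finite_reachable (G₀ : TypedGraph N) (m t : ℕ) : (reachable G₀ m t).Finite := by
  induction t with
  | zero => exact Set.finite_singleton _
  | succ t ih =>
    refine (ih.biUnion fun G _ => Set.finite_range
      fun p : (Fin m → Fin G.n) × Fin N => G.addVertex p.1 p.2).subset ?_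
    rintro H ⟨G, hG, w, c, rfl⟩
    exact Set.mem_biUnion hG ⟨(w, c), rfl⟩

theorem totalDegree_of_mem_reachable {G₀ H : TypedGraph N} {m t : ℕ}
    (h : H ∈ reachable G₀ m t) : H.totalDegree = G₀.totalDegree + 2 * m * t := by
  induction t generalizing H with
  | zero => rw [Set.mem_singleton_iff.1 h]; simp
  | succ t ih =>
    obtain ⟨G, hG, w, c, rfl⟩ := h
    rw [totalDegree_addVertex, ih hG]
    ring

theorem n_of_mem_reachable {G₀ H : TypedGraph N} {m t : ℕ}
    (h : H ∈ reachable G₀ m t) : H.n = G₀.n + t := by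
  induction t generalizing H with
  | zero => rw [Set.mem_singleton_iff.1 h]; simp
  | succ t ih =>
    obtain ⟨G, hG, w, c, rfl⟩ := h
    rw [← add_assoc, ← ih hG]
    rfl

theorem typeDegree_pos_of_mem_reachable {G₀ H : TypedGraph N} {m t : ℕ}
    (h₀ : ∀ i, 1 ≤ G₀.typeDegree i) (h : H ∈ reachable G₀ m t) (i : Fin N) :
    1 ≤ H.typeDegree i := by
  induction t generalizing H with
  | zero => rw [Set.mem_singleton_iff.1 h]; exact h₀ i
  | succ t ih =>
    obtain ⟨G, hG, w, c, rfl⟩ := h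
    rw [typeDegree_addVertex]
    have := ih hG
    omega

theorem degreeProportion_pos {G : TypedGraph N} (hG : ∀ i, 1 ≤ G.typeDegree i) (i : Fin N) :
    0 < G.degreeProportion i := by
  rw [degreeProportion_eq]
  have h1 : (0 : ℝ) < G.typeDegree i := by exact_mod_cast hG i
  have h2 : (0 : ℝ) < G.totalDegree := by exact_mod_cast G.totalDegree_pos
  positivity

/-- The added terms sum to zero, and they make each summand nonnegative. -/
theorem sum_neg_log_eq [NeZero N] (G : TypedGraph N) :
    ∑ i, -Real.log (N * G.degreeProportion i) =
      ∑ i, (N * G.degreeProportion i - 1 - Real.log (N * G.degreeProportion i)) := by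
  simp only [Finset.sum_sub_distrib, ← Finset.mul_sum, sum_degreeProportion]
  simp

theorem sq_sqrt_sub_one_le {y : ℝ} (hy : 0 < y) : (√y - 1) ^ 2 ≤ y - 1 - Real.log y := by
  have h1 : Real.log y = 2 * Real.log √y := by
    rw [Real.log_sqrt hy.le]; ring
  have h2 := Real.log_le_sub_one_of_pos (Real.sqrt_pos.2 hy)
  have h3 := Real.sq_sqrt hy.le
  nlinarith

theorem sum_neg_log_nonneg [NeZero N] {G : TypedGraph N} (hG : ∀ i, 1 ≤ G.typeDegree i) :
    0 ≤ ∑ i, -Real.log (N * G.degreeProportion i) := by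
  have hN : (0 : ℝ) < N := by exact_mod_cast Nat.pos_of_ne_zero (NeZero.ne N)
  rw [sum_neg_log_eq]
  exact Finset.sum_nonneg fun i _ => (sq_nonneg _).trans
    (sq_sqrt_sub_one_le (mul_pos hN (degreeProportion_pos hG i)))

theorem sq_sqrt_sub_one_le_potential [NeZero N] {G : TypedGraph N} {ε : ℝ} (hε : 0 ≤ ε) (m : ℕ)
    (hG : ∀ i, 1 ≤ G.typeDegree i) (i : Fin N) :
    (√(N * G.degreeProportion i) - 1) ^ 2 ≤ G.potential ε m := by
  have hN : (0 : ℝ) < N := by exact_mod_cast Nat.pos_of_ne_zero (NeZero.ne N)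
  have h0 : ∀ j, (√(N * G.degreeProportion j) - 1) ^ 2 ≤
      N * G.degreeProportion j - 1 - Real.log (N * G.degreeProportion j) := fun j =>
    sq_sqrt_sub_one_le (mul_pos hN (degreeProportion_pos hG j))
  calc (√(N * G.degreeProportion i) - 1) ^ 2
      ≤ N * G.degreeProportion i - 1 - Real.log (N * G.degreeProportion i) := h0 i
    _ ≤ ∑ j, (N * G.degreeProportion j - 1 - Real.log (N * G.degreeProportion j)) :=
        Finset.single_le_sum
          (f := fun j => N * G.degreeProportion j - 1 - Real.log (N * G.degreeProportion j))
          (fun j _ => (sq_nonneg _).trans (h0 j)) (Finset.mem_univ i)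
    _ = ∑ j, -Real.log (N * G.degreeProportion j) := G.sum_neg_log_eq.symm
    _ ≤ G.potential ε m := Finset.sum_le_sum fun j _ => by
        unfold typePotential
        rw [add_assoc]
        exact le_add_of_nonneg_right (by positivity)

theorem mul_sq_oldEndsDeviation_le_potential [NeZero N] {G : TypedGraph N} {ε : ℝ} (hε : 0 ≤ ε)
    (m : ℕ) (hG : ∀ i, 1 ≤ G.typeDegree i) (i : Fin N) :
    ε * G.oldEndsDeviation m i ^ 2 ≤ G.potential ε m := by
  have h1 : ε * G.oldEndsDeviation m i ^ 2 ≤ ∑ j, ((1 + 2 * m) * (m + 1) *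
      (G.typeDegree j : ℝ)⁻¹ + ε * G.oldEndsDeviation m j ^ 2) := by
    refine le_trans ?_ (Finset.single_le_sum (f := fun j => ((1 + 2 * m) * (m + 1) *
      (G.typeDegree j : ℝ)⁻¹ + ε * G.oldEndsDeviation m j ^ 2))
      (fun j _ => by positivity) (Finset.mem_univ i))
    exact le_add_of_nonneg_left (by positivity)
  have h2 := sum_neg_log_nonneg hG
  have h3 : G.potential ε m = ∑ j, -Real.log (N * G.degreeProportion j) + ∑ j, ((1 + 2 * m) *
      (m + 1) * (G.typeDegree j : ℝ)⁻¹ + ε * G.oldEndsDeviation m j ^ 2) := by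
    rw [← Finset.sum_add_distrib]
    exact Finset.sum_congr rfl fun j _ => by unfold typePotential; ring
  linarith

theorem decayRate_nonneg {ε : ℝ} (hε : 0 ≤ ε) (m : ℕ) (G : TypedGraph N) :
    0 ≤ G.decayRate ε m :=
  Finset.sum_nonneg fun i _ => by positivity

/-- The Lyapunov function is small wherever its rate of decrease is small. -/
theorem tendsto_potential_of_tendsto_decayRate [NeZero N] {α : Type*} {l : Filter α}
    {G : α → TypedGraph N} {ε : ℝ} (hε : 0 < ε) {m : ℕ} (hm : 0 < m)
    (h : Tendsto (fun a => (G a).decayRate ε m) l (𝓝 0)) :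
    Tendsto (fun a => (G a).potential ε m) l (𝓝 0) := by
  have hN : (N : ℝ) ≠ 0 := by exact_mod_cast NeZero.ne N
  have hm0 : (0 : ℝ) < m := by exact_mod_cast hm
  have hterm : ∀ i a, m * ε * ((G a).degreeProportion i - 1 / N) ^ 2 +
      m * ((G a).typeDegree i : ℝ)⁻¹ + ε / 2 * (G a).oldEndsDeviation m i ^ 2 ≤
        (G a).decayRate ε m := fun i a =>
    Finset.single_le_sum (f := fun i => m * ε * ((G a).degreeProportion i - 1 / N) ^ 2 +
      m * ((G a).typeDegree i : ℝ)⁻¹ + ε / 2 * (G a).oldEndsDeviation m i ^ 2)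
      (fun j _ => by positivity) (Finset.mem_univ i)
  have hx : ∀ i, Tendsto (fun a => (G a).degreeProportion i) l (𝓝 (1 / N)) := by
    intro i
    have h1 : Tendsto (fun a => (G a).degreeProportion i - 1 / N) l (𝓝 0) := by
      refine tendsto_zero_of_sq (tendsto_zero_of_mul_le (mul_pos hm0 hε)
        (.of_forall fun a => sq_nonneg _) (.of_forall fun a => ?_) h)
      have h2 := hterm i a
      have h3 : 0 ≤ m * ((G a).typeDegree i : ℝ)⁻¹ + ε / 2 * (G a).oldEndsDeviation m i ^ 2 := by
        positivity
      linarith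
    simpa using h1.add_const (1 / (N : ℝ))
  have hY : ∀ i, Tendsto (fun a => ((G a).typeDegree i : ℝ)⁻¹) l (𝓝 0) := by
    intro i
    refine tendsto_zero_of_mul_le hm0 (.of_forall fun a => by positivity)
      (.of_forall fun a => ?_) h
    have h2 := hterm i a
    have h3 : 0 ≤ m * ε * ((G a).degreeProportion i - 1 / N) ^ 2 +
        ε / 2 * (G a).oldEndsDeviation m i ^ 2 := by positivity
    linarith
  have hβ : ∀ i, Tendsto (fun a => (G a).oldEndsDeviation m i ^ 2) l (𝓝 0) := by
    intro i
    refine tendsto_zero_of_mul_le (half_pos hε) (.of_forall fun a => sq_nonneg _)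
      (.of_forall fun a => ?_) h
    have h2 := hterm i a
    have h3 : 0 ≤ m * ε * ((G a).degreeProportion i - 1 / N) ^ 2 +
        m * ((G a).typeDegree i : ℝ)⁻¹ := by positivity
    linarith
  have hi : ∀ i, Tendsto (fun a => (G a).typePotential ε m i) l (𝓝 0) := by
    intro i
    have h1 : Tendsto (fun a => N * (G a).degreeProportion i) l (𝓝 1) := by
      have := (hx i).const_mul (N : ℝ)
      rwa [mul_one_div_cancel hN] at this
    have h2 := ((h1.log one_ne_zero).neg.add ((hY i).const_mul ((1 + 2 * m) * (m + 1) : ℝ))).add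
      ((hβ i).const_mul ε)
    simpa [typePotential] using h2
  simpa [potential] using tendsto_finsetSum Finset.univ fun i _ => hi i

end TypedGraph

/-! ### Almost sure convergence of the potential -/

/-- If `D / T` is summable and `T` grows linearly, then `D` has `0` as a cluster point. -/
theorem mapClusterPt_zero_of_summable_div {D : ℕ → ℝ} (hD : ∀ t, 0 ≤ D t) {a b : ℝ} (ha : 0 < a)
    (hb : 0 < b) (h : Summable fun t : ℕ => D t / (a + b * t)) : MapClusterPt 0 atTop D := by
  have hfreq : ∀ δ > 0, ∃ᶠ t in atTop, D t < δ := by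
    intro δ hδ hcon
    have hcon' : ∀ᶠ t in atTop, δ ≤ D t := hcon.mono fun t ht => not_lt.1 ht
    have h1 : Summable fun t : ℕ => δ / (a + b) * (1 / ((t : ℝ) + 1)) := by
      refine h.of_norm_bounded_eventually_nat (hcon'.mono fun t ht => ?_)
      rw [Real.norm_of_nonneg (by positivity), div_mul_div_comm, mul_one]
      have h0 : (0 : ℝ) ≤ t := Nat.cast_nonneg t
      exact div_le_div₀ (hD t) ht (by positivity) (by nlinarith)
    have h2 : Summable fun t : ℕ => 1 / ((t : ℝ) + 1) :=
      (summable_mul_left_iff (by positivity)).1 h1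
    have h3 : Summable fun t : ℕ => 1 / ((t : ℝ)) :=
      (summable_nat_add_iff 1).1 (by simpa using h2)
    exact Real.not_summable_one_div_natCast h3
  rw [mapClusterPt_iff_frequently]
  intro s hs
  obtain ⟨δ, hδ, hball⟩ := Metric.mem_nhds_iff.1 hs
  refine (hfreq δ hδ).mono fun t ht => hball ?_
  rw [Metric.mem_ball, Real.dist_eq, sub_zero, abs_of_nonneg (hD t)]
  exact ht

theorem summable_div_linear_sq {a b : ℝ} (ha : 0 < a) (hb : 0 < b) (C : ℝ) :
    Summable fun t : ℕ => C / (a + b * t) ^ 2 := by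
  have h1 : Summable fun t : ℕ => 1 / (t : ℝ) ^ 2 := Real.summable_one_div_nat_pow.2 one_lt_two
  refine (h1.mul_left (|C| / b ^ 2)).of_norm_bounded_eventually_nat ?_
  filter_upwards [eventually_gt_atTop 0] with t ht
  have ht' : (0 : ℝ) < t := by exact_mod_cast ht
  rw [norm_div, Real.norm_eq_abs, Real.norm_of_nonneg (by positivity), div_mul_div_comm, mul_one,
    ← mul_pow]
  gcongr
  linarith

/-- Almost surely the Lyapunov function tends to `0` along the process. -/
theorem IsVisibleTypeProcess.ae_tendsto_potential {Ω : Type*} {mΩ : MeasurableSpace Ω}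
    {μ : Measure Ω} [IsProbabilityMeasure μ] {ℱ : Filtration ℕ mΩ} {N n : ℕ} [NeZero N]
    (hn : 2 ≤ n) {G₀ : TypedGraph N} (hG₀ : ∀ i, 1 ≤ G₀.typeDegree i)
    {G : ℕ → Ω → TypedGraph N} {hm : 0 < n + 1} (hG : IsVisibleTypeProcess μ ℱ (n + 1) hm G₀ G)
    (hmem : ∀ᵐ ω ∂μ, ∀ t, G t ω ∈ TypedGraph.reachable G₀ (n + 1) t) {ε : ℝ}
    (hε : ε = ((n : ℝ) - 1) / 8 * (1 / N : ℝ) ^ n) :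
    ∀ᵐ ω ∂μ, Tendsto (fun t => (G t ω).potential ε (n + 1)) atTop (𝓝 0) := by
  have hn' : (2 : ℝ) ≤ n := by exact_mod_cast hn
  have hN : (0 : ℝ) < N := by exact_mod_cast Nat.pos_of_ne_zero (NeZero.ne N)
  have hε0 : 0 < ε := by
    rw [hε]
    exact mul_pos (by linarith) (by positivity)
  have hfin := TypedGraph.finite_reachable G₀ (n + 1)
  have hT₀ : (0 : ℝ) < G₀.totalDegree := by exact_mod_cast G₀.totalDegree_pos
  set b : ℝ := 2 * (n + 1 : ℕ) with hb
  have hb0 : 0 < b := by positivity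
  have hT : ∀ t, ∀ H ∈ TypedGraph.reachable G₀ (n + 1) t,
      (H.totalDegree : ℝ) = G₀.totalDegree + b * t := by
    intro t H hH
    rw [TypedGraph.totalDegree_of_mem_reachable hH, hb]
    push_cast
    ring
  set C : ℝ := N * (ε * (n + 1 : ℕ) ^ 2) with hC
  have hC0 : 0 ≤ C := by positivity
  have hadapt : ∀ f : TypedGraph N → ℝ, StronglyAdapted ℱ fun t ω => f (G t ω) := fun f t =>
    ((Measurable.of_discrete (f := f)).comp (hG.adapted t)).stronglyMeasurable
  have hint := integrable_comp_of_ae_mem hfin hG.adapted hmem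
  have hRS := ae_tendsto_and_summable_of_almost_supermartingale (μ := μ)
    (hadapt fun H => H.potential ε (n + 1))
    (hadapt fun H => H.decayRate ε (n + 1) / H.totalDegree)
    (hint _) (hint fun H => H.decayRate ε (n + 1) / H.totalDegree)
    (e := fun t : ℕ => C / (G₀.totalDegree + b * t) ^ 2)
    (fun t => by
      filter_upwards [hmem] with ω hω
      -- Nonnegativity of the potential follows from its lower bound at any one type; type `0` is
      -- used.
      exact (sq_nonneg _).trans (TypedGraph.sq_sqrt_sub_one_le_potential hε0.le (n + 1)
        (TypedGraph.typeDegree_pos_of_mem_reachable hG₀ (hω t)) 0))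
    (fun t => .of_forall fun ω =>
      div_nonneg (TypedGraph.decayRate_nonneg hε0.le _ _) (Nat.cast_nonneg _))
    (fun t => by positivity) (summable_div_linear_sq hT₀ hb0 C)
    (fun t => by
      filter_upwards [condExp_comp_eq_sum (κ := fun H => H.visibleStep (n + 1) hm) hfin hG.adapted
        hmem hG.step
        (fun H => H.potential ε (n + 1)) t, hmem] with ω h1 h2
      rw [h1, TypedGraph.sum_mul_visibleStep _ _ _
        fun w c => (hfin (t + 1)).mem_toFinset.2 ⟨_, h2 t, w, c, rfl⟩, ← hT t _ (h2 t)]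
      exact TypedGraph.stepMean_potential_le _ hn
        (TypedGraph.typeDegree_pos_of_mem_reachable hG₀ (h2 t)) hε)
  filter_upwards [hRS, hmem] with ω ⟨⟨L, hL⟩, hsum⟩ hω
  have hcl : MapClusterPt 0 atTop fun t => (G t ω).decayRate ε (n + 1) := by
    refine mapClusterPt_zero_of_summable_div
      (fun t => TypedGraph.decayRate_nonneg hε0.le _ _) hT₀ hb0 (hsum.congr fun t => ?_)
    rw [hT t _ (hω t)]
  -- Along `U` the decay rate, hence the potential, tends to `0`; the full limit `L` must agree.
  obtain ⟨U, hU, hUlim⟩ := mapClusterPt_iff_ultrafilter.1 hcl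
  have h0 := TypedGraph.tendsto_potential_of_tendsto_decayRate hε0 hm hUlim
  rwa [tendsto_nhds_unique (hL.mono_left hU) h0] at hL

theorem IsVisibleTypeProcess.ae_mem_reachable {Ω : Type*} {mΩ : MeasurableSpace Ω}
    {μ : Measure Ω} [IsProbabilityMeasure μ] {ℱ : Filtration ℕ mΩ} {N m : ℕ} {hm : 0 < m}
    {G₀ : TypedGraph N} {G : ℕ → Ω → TypedGraph N} (hG : IsVisibleTypeProcess μ ℱ m hm G₀ G) :
    ∀ᵐ ω ∂μ, ∀ t, G t ω ∈ TypedGraph.reachable G₀ m t :=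
  ae_mem_of_condExp_eq (fun _ x hx y hy => x.visibleStep_eq_zero hm y
    fun w c h => hy ⟨x, hx, w, c, h⟩) hG.adapted hG.init hG.step

end

/-! ### From the potential to the proportions -/

theorem mainTheorem3 {Ω : Type*} {mΩ : MeasurableSpace Ω} (μ : Measure Ω) [IsProbabilityMeasure μ]
    (ℱ : Filtration ℕ mΩ) (N m : ℕ) (hN : 2 ≤ N) (hm : 3 ≤ m)
    (G₀ : TypedGraph N) (hG₀ : ∀ i : Fin N, ∃ v, G₀.type v = i ∧ 0 < G₀.degree v)
    (G : ℕ → Ω → TypedGraph N)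
    (hG : IsVisibleTypeProcess μ ℱ m (lt_of_lt_of_le three_pos hm) G₀ G) :
    ∀ᵐ ω ∂μ, ∀ i : Fin N,
      Tendsto (fun t => (G t ω).vertexProportion i) atTop (𝓝 (1 / (N : ℝ))) ∧
      Tendsto (fun t => (G t ω).degreeProportion i) atTop (𝓝 (1 / (N : ℝ))) := by
  obtain ⟨n, rfl⟩ : ∃ n, m = n + 1 := ⟨m - 1, by omega⟩
  have : NeZero N := ⟨by omega⟩
  have hn : 2 ≤ n := by omega
  have hn' : (2 : ℝ) ≤ n := by exact_mod_cast hn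
  have hN0 : (0 : ℝ) < N := by exact_mod_cast Nat.pos_of_ne_zero (NeZero.ne N)
  have hY₀ : ∀ i, 1 ≤ G₀.typeDegree i := by
    intro i
    obtain ⟨v, hv, hd⟩ := hG₀ i
    exact (Nat.succ_le_of_lt hd).trans (Finset.single_le_sum (f := G₀.degree) (fun _ _ => Nat.zero_le _)
      (Finset.mem_filter.2 ⟨Finset.mem_univ v, hv⟩))
  have hε0 : 0 < ((n : ℝ) - 1) / 8 * (1 / N : ℝ) ^ n := mul_pos (by linarith) (by positivity)
  have hmem := hG.ae_mem_reachable
  filter_upwards [hG.ae_tendsto_potential hn hY₀ hmem rfl, hmem] with ω hpot hω i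
  set ε : ℝ := ((n : ℝ) - 1) / 8 * (1 / N : ℝ) ^ n
  have hpos : ∀ t, ∀ j, 1 ≤ (G t ω).typeDegree j := fun t =>
    TypedGraph.typeDegree_pos_of_mem_reachable hY₀ (hω t)
  have hdeg : Tendsto (fun t => (G t ω).degreeProportion i) atTop (𝓝 (1 / (N : ℝ))) := by
    have h1 : Tendsto (fun t => √(N * (G t ω).degreeProportion i) - 1) atTop (𝓝 0) :=
      tendsto_zero_of_sq (squeeze_zero (fun t => sq_nonneg _)
        (fun t => TypedGraph.sq_sqrt_sub_one_le_potential hε0.le (n + 1) (hpos t) i) hpot)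
    have h2 := ((h1.add_const 1).pow 2).div_const (N : ℝ)
    rw [zero_add, one_pow] at h2
    refine h2.congr fun t => ?_
    rw [sub_add_cancel, Real.sq_sqrt
      (mul_pos hN0 (TypedGraph.degreeProportion_pos (hpos t) i)).le]
    field_simp
  refine ⟨?_, hdeg⟩
  have hβ : Tendsto (fun t => (G t ω).oldEndsDeviation (n + 1) i) atTop (𝓝 0) :=
    tendsto_zero_of_sq (tendsto_zero_of_mul_le hε0 (.of_forall fun t => sq_nonneg _)
      (.of_forall fun t =>
        TypedGraph.mul_sq_oldEndsDeviation_le_potential hε0.le (n + 1) (hpos t) i) hpot)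
  have hratio : Tendsto (fun t => ((G t ω).totalDegree : ℝ) / (G t ω).n) atTop
      (𝓝 (2 * (n + 1))) := by
    have h1 : Tendsto (fun t : ℕ => ((G₀.totalDegree - 2 * (n + 1) * G₀.n : ℝ)) /
        ((G₀.n + t : ℕ) : ℝ) + 2 * (n + 1)) atTop (𝓝 (0 + 2 * (n + 1))) := by
      refine Tendsto.add_const _ (Tendsto.const_div_atTop ?_ _)
      exact tendsto_natCast_atTop_atTop.comp (tendsto_atTop_mono (fun t => Nat.le_add_left t G₀.n) tendsto_id)
    rw [zero_add] at h1
    refine h1.congr' ?_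
    filter_upwards [eventually_gt_atTop 0] with t ht
    rw [TypedGraph.totalDegree_of_mem_reachable (hω t), TypedGraph.n_of_mem_reachable (hω t)]
    have : ((G₀.n + t : ℕ) : ℝ) ≠ 0 := by positivity
    push_cast at this ⊢
    field_simp
    ring
  have hn0 : (n : ℝ) + 1 ≠ 0 := by positivity
  -- Subtracting `β` and `1 / (2 * N)` from the degree proportion leaves `m * typeCount /
  -- totalDegree`; multiplying by `totalDegree / n` (the vertex count) and dividing by `m` gives the
  -- vertex proportion.
  have h3 := (hratio.mul ((hdeg.sub hβ).sub_const (1 / (2 * N : ℝ)))).div_const ((n : ℝ) + 1)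
  have e : 2 * ((n : ℝ) + 1) * (1 / N - 0 - 1 / (2 * N)) / (n + 1) = 1 / N := by
    field_simp
    ring
  rw [e] at h3
  refine h3.congr fun t => ?_
  have hT : ((G t ω).totalDegree : ℝ) ≠ 0 := by exact_mod_cast (G t ω).totalDegree_pos.ne'
  have hV : (G t ω).vertexProportion i = (G t ω).typeCount i / (G t ω).n := rfl
  rw [TypedGraph.oldEndsDeviation, TypedGraph.degreeProportion_eq, hV]
  push_cast
  field_simp
  ring
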